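/- Let $c\ge 0$, let $\mathbb H_c=L^2(\mathbb R,e^{-2ct}\,dt)$ be the Hilbert space of complex-valued functions that are square integrable for the measure $e^{-2ct}\,dt$, and let $\partial_c$ be the operator $\partial_c f=f'$ on $\mathbb H_c$ with domain $$D(\partial_c)=\{f\in\mathbb H_c:\ f \text{ locally absolutely continuous on }\mathbb R,\ f'\in\mathbb H_c\}.$$ Then $\partial_c=\int_{\mathbb C} z\,dE(z)$ for a projection-valued measure $E$ on the Borel sets of $\mathbb C$. Let $\mathfrak a_c=\zeta(\partial_c)=\int\zeta\,dE$, with domain $\{f\in\mathbb H_c:\int|\zeta|^2\,d\langle Ef,f\rangle<\infty\}$, be the spectral operator, defined by the measurable functional calculus for unbounded normal operators, where $\zeta$ is the Riemann zeta function. Then $$\sigma(\mathfrak a_c)=\overline{\zeta(\sigma(\partial_c)\setminus\{1\})}=\overline{\zeta(\{s\in\mathbb C:\ \operatorname{Re}s=c,\ s\neq 1\})},$$ where $\sigma(A)$ denotes the spectrum of a (possibly unbounded) operator $A$, i.e. the set of $\lambda\in\mathbb C$ for which $A-\lambda$ has no bounded everywhere defined two-sided inverse, and the bar denotes closure in $\mathbb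 C$. (The pole $s=1$ of $\zeta$ lies on the line only when $c=1$.) -/

import Mathlib

open MeasureTheory Filter Topology
open scoped ENNReal

noncomputable section

namespace SpectralOp

section Operators

variable {H : Type*} [NormedAddCommGroup H] [InnerProductSpace ℂ H] [CompleteSpace H]

/-- `z` is in the resolvent set of the (possibly unbounded) operator `A`: there is a bounded
everywhere defined operator `R` with values in the domain of `A` such that `(A - z) R u = u` for
all `u`, and `R (A - z) v = v` for all `v` in the domain of `A`. -/
def InResolventSet (A : H →ₗ.[ℂ] H) (z : ℂ) : Prop :=
  ∃ R : H →L[ℂ] H,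
    (∀ u : H, ∃ v : A.domain, (v : H) = R u ∧ A v - z • (v : H) = u) ∧
    (∀ v : A.domain, R (A v - z • (v : H)) = v)

/-- The spectrum of a (possibly unbounded) operator. -/
def opSpectrum (A : H →ₗ.[ℂ] H) : Set ℂ :=
  {z | ¬ InResolventSet A z}

variable (H) in
/-- A resolution of the identity (projection-valued measure) on the Borel sets of `ℂ`. The value on
non-Borel sets is the dummy value `0`. -/
structure ResolutionOfIdentity where
  proj : Set ℂ → H →L[ℂ] H
  not_measurable : ∀ B, ¬ MeasurableSet B → proj B = 0
  isStarProjection : ∀ B, MeasurableSet B → IsStarProjection (proj B)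
  univ : proj Set.univ = 1
  inter : ∀ B C, MeasurableSet B → MeasurableSet C → proj (B ∩ C) = proj B * proj C
  iUnion : ∀ B : ℕ → Set ℂ, (∀ n, MeasurableSet (B n)) → Pairwise (fun i j => Disjoint (B i) (B j)) →
    ∀ x : H, HasSum (fun n => proj (B n) x) (proj (⋃ n, B n) x)

namespace ResolutionOfIdentity

variable (E : ResolutionOfIdentity H)

theorem proj_empty : E.proj ∅ = 0 := by
  ext x
  have h := E.iUnion (fun _ => ∅) (fun _ => MeasurableSet.empty) (fun _ _ _ => by simp) x
  have h0 := h.summable.tendsto_atTop_zero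
  simpa using tendsto_nhds_unique tendsto_const_nhds h0

theorem inner_proj_self {B : Set ℂ} (hB : MeasurableSet B) (x : H) :
    inner ℂ x (E.proj B x) = ((‖E.proj B x‖ ^ 2 : ℝ) : ℂ) := by
  have hp := E.isStarProjection B hB
  have h1 : E.proj B (E.proj B x) = E.proj B x :=
    congrArg (fun T : H →L[ℂ] H => T x) hp.isIdempotentElem
  have h2 := hp.isSelfAdjoint.isSymmetric x (E.proj B x)
  simp only [ContinuousLinearMap.coe_coe] at h2
  rw [h1] at h2
  rw [← h2, inner_self_eq_norm_sq_to_K]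
  simp

theorem hasSum_norm_sq (x : H) (B : ℕ → Set ℂ) (hB : ∀ n, MeasurableSet (B n))
    (hd : Pairwise (fun i j => Disjoint (B i) (B j))) :
    HasSum (fun n => ‖E.proj (B n) x‖ ^ 2) (‖E.proj (⋃ n, B n) x‖ ^ 2) := by
  have h := (E.iUnion B hB hd x).mapL (innerSL ℂ x)
  simp only [innerSL_apply_apply, E.inner_proj_self (hB _),
    E.inner_proj_self (MeasurableSet.iUnion hB)] at h
  exact Complex.hasSum_ofReal.mp h

/-- The positive measure `B ↦ ⟨E(B) x, x⟩ = ‖E(B) x‖²`. -/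
def measure (x : H) : Measure ℂ :=
  Measure.ofMeasurable (fun B _ => ENNReal.ofReal (‖E.proj B x‖ ^ 2))
    (by simp [proj_empty])
    (fun B hB hd => by
      have h := E.hasSum_norm_sq x B hB hd
      rw [← h.tsum_eq, ENNReal.ofReal_tsum_of_nonneg (fun n => by positivity) h.summable])

theorem measure_apply (x : H) {B : Set ℂ} (hB : MeasurableSet B) :
    E.measure x B = ENNReal.ofReal (‖E.proj B x‖ ^ 2) :=
  Measure.ofMeasurable_apply B hB

theorem measure_add_le (x y : H) :
    E.measure (x + y) ≤ (2 : ℝ≥0∞) • (E.measure x + E.measure y) := by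
  refine Measure.le_iff.2 fun B hB => ?_
  simp only [Measure.smul_apply, Measure.add_apply, smul_eq_mul, E.measure_apply _ hB]
  rw [← ENNReal.ofReal_add (by positivity) (by positivity),
    ← ENNReal.ofReal_ofNat 2, ← ENNReal.ofReal_mul (by norm_num)]
  apply ENNReal.ofReal_le_ofReal
  have h1 : ‖E.proj B (x + y)‖ ≤ ‖E.proj B x‖ + ‖E.proj B y‖ := by
    rw [map_add]; exact norm_add_le _ _
  have h2 := norm_nonneg (E.proj B (x + y))
  nlinarith [sq_nonneg (‖E.proj B x‖ - ‖E.proj B y‖)]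

theorem measure_smul (a : ℂ) (x : H) :
    E.measure (a • x) = ENNReal.ofReal (‖a‖ ^ 2) • E.measure x := by
  refine Measure.ext fun B hB => ?_
  simp only [Measure.smul_apply, smul_eq_mul, E.measure_apply _ hB]
  rw [← ENNReal.ofReal_mul (by positivity), map_smul, norm_smul, mul_pow]

/-- `∫ s dE` for a simple function `s`. -/
def simpleIntegral (s : SimpleFunc ℂ ℂ) : H →L[ℂ] H :=
  ∑ z ∈ s.range, z • E.proj (s ⁻¹' {z})

/-- The graph of `f(E) = ∫ f dE` for a Borel function `f`. Its domain consists of the vectors `x`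
with `∫ |f|² d⟨E x, x⟩ < ∞`, and `∫ f dE x` is the limit of `∫ sₙ dE x` for simple functions
`sₙ → f` dominated by a constant multiple of `|f|` (the limit exists and does not depend on the
sequence, by dominated convergence in `L²(⟨E x, x⟩)`). -/
def integralGraph (f : ℂ → ℂ) : Submodule ℂ (H × H) where
  carrier := {p | ∫⁻ z, ‖f z‖ₑ ^ 2 ∂(E.measure p.1) < ∞ ∧
    ∀ (s : ℕ → SimpleFunc ℂ ℂ) (C : ℝ), (∀ n z, ‖s n z‖ ≤ C * ‖f z‖) →
      (∀ z, Tendsto (fun n => s n z) atTop (𝓝 (f z))) →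
      Tendsto (fun n => E.simpleIntegral (s n) p.1) atTop (𝓝 p.2)}
  add_mem' := by
    rintro ⟨x, x'⟩ ⟨y, y'⟩ ⟨hx, hx'⟩ ⟨hy, hy'⟩
    refine ⟨?_, fun s C hC hs => ?_⟩
    · refine (lintegral_mono' (E.measure_add_le x y) le_rfl).trans_lt ?_
      rw [lintegral_smul_measure, lintegral_add_measure]
      exact ENNReal.mul_lt_top (by simp) (ENNReal.add_lt_top.2 ⟨hx, hy⟩)
    · simpa using (hx' s C hC hs).add (hy' s C hC hs)
  zero_mem' := by
    refine ⟨?_, fun s C _ _ => by simp⟩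
    have h : E.measure (0 : H) = 0 := by
      refine Measure.ext fun B hB => ?_
      simp [E.measure_apply _ hB]
    simp [h]
  smul_mem' := by
    rintro a ⟨x, x'⟩ ⟨hx, hx'⟩
    refine ⟨?_, fun s C hC hs => ?_⟩
    · simp only [Prod.smul_mk, E.measure_smul]
      rw [lintegral_smul_measure]
      exact ENNReal.mul_lt_top ENNReal.ofReal_lt_top hx
    · simpa using (hx' s C hC hs).const_smul a

/-- The operator `∫ f dE`, for a Borel function `f`. -/
def integral (f : ℂ → ℂ) : H →ₗ.[ℂ] H :=
  (E.integralGraph f).toLinearPMap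

end ResolutionOfIdentity

/-- `E` is the resolution of the identity (spectral measure) of the operator `A`, i.e.
`A = ∫ z dE(z)`. -/
def IsResolutionOf (E : ResolutionOfIdentity H) (A : H →ₗ.[ℂ] H) : Prop :=
  E.integral id = A

open Classical in
/-- The measurable functional calculus `f(A) = ∫ f dE`, where `E` is the resolution of the identity
of the normal operator `A` (with the dummy value `⊥` if there is none). -/
def functionalCalculus (A : H →ₗ.[ℂ] H) (f : ℂ → ℂ) : H →ₗ.[ℂ] H :=
  if h : ∃ E : ResolutionOfIdentity H, IsResolutionOf E A then h.choose.integral f else ⊥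

end Operators

section Shift

/-- The measure `e^{-2ct} dt` on the real line. -/
def weightMeasure (c : ℝ) : Measure ℝ :=
  volume.withDensity (fun t => ENNReal.ofReal (Real.exp (-2 * c * t)))

/-- The Hilbert space `L²(ℝ, e^{-2ct} dt)` of complex-valued functions. -/
abbrev WeightedL2 (c : ℝ) : Type := Lp ℂ 2 (weightMeasure c)

/-- Local absolute continuity on the real line. -/
def LocallyAC (g : ℝ → ℂ) : Prop :=
  ∀ a b : ℝ, AbsolutelyContinuousOnInterval g a b

theorem weightMeasure_ac (c : ℝ) : weightMeasure c ≪ volume :=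
  withDensity_absolutelyContinuous _ _

theorem LocallyAC.ae_differentiableAt {g : ℝ → ℂ} (hg : LocallyAC g) (c : ℝ) :
    ∀ᵐ t ∂(weightMeasure c), DifferentiableAt ℝ g t := by
  apply (weightMeasure_ac c).ae_le
  have h : ∀ n : ℕ, ∀ᵐ t : ℝ, t ∈ Set.uIcc (-(n : ℝ)) n → DifferentiableAt ℝ g t := fun n =>
    (hg _ _).boundedVariationOn.ae_differentiableAt_of_mem_uIcc
  filter_upwards [ae_all_iff.2 h] with t ht
  obtain ⟨n, hn⟩ := exists_nat_ge |t|
  refine ht n ?_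
  have := abs_le.1 hn
  rw [Set.uIcc_of_le (by linarith)]
  exact this

/-- The graph of the differentiation operator: pairs `(f, f')` in `L²(ℝ, e^{-2ct} dt)` such that
`f` is (represented by) a locally absolutely continuous function. -/
def shiftGraph (c : ℝ) : Submodule ℂ (WeightedL2 c × WeightedL2 c) where
  carrier := {p | ∃ g : ℝ → ℂ, LocallyAC g ∧ p.1 =ᵐ[weightMeasure c] g ∧
    p.2 =ᵐ[weightMeasure c] deriv g}
  add_mem' := by
    rintro ⟨x, x'⟩ ⟨y, y'⟩ ⟨g, hg, hx, hx'⟩ ⟨k, hk, hy, hy'⟩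
    refine ⟨g + k, fun a b => (hg a b).add (hk a b), ?_, ?_⟩
    · exact (Lp.coeFn_add x y).trans (hx.add hy)
    · refine (Lp.coeFn_add x' y').trans ?_
      filter_upwards [hx', hy', hg.ae_differentiableAt c, hk.ae_differentiableAt c]
        with t h1 h2 h3 h4
      rw [Pi.add_apply, deriv_add h3 h4]
      exact congrArg₂ _ h1 h2
  zero_mem' := by
    refine ⟨fun _ => 0, fun a b => ?_, Lp.coeFn_zero _ _ _, ?_⟩
    · simp [AbsolutelyContinuousOnInterval, tendsto_const_nhds]
    · filter_upwards [Lp.coeFn_zero ℂ 2 (weightMeasure c)] with t ht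
      simpa using ht
  smul_mem' := by
    rintro a ⟨x, x'⟩ ⟨g, hg, hx, hx'⟩
    refine ⟨fun t => a • g t, fun p q => (hg p q).const_smul a, ?_, ?_⟩
    · refine (Lp.coeFn_smul a x).trans ?_
      filter_upwards [hx] with t h1
      exact congrArg (a • ·) h1
    · refine (Lp.coeFn_smul a x').trans ?_
      filter_upwards [hx', hg.ae_differentiableAt c] with t h1 h2
      rw [Pi.smul_apply, deriv_fun_const_smul a h2]
      exact congrArg (a • ·) h1

/-- The infinitesimal shift `∂_c f = f'`, with domain the (classes of) locally absolutely continuous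
`f ∈ L²(ℝ, e^{-2ct} dt)` with `f' ∈ L²(ℝ, e^{-2ct} dt)`. -/
def infinitesimalShift (c : ℝ) : WeightedL2 c →ₗ.[ℂ] WeightedL2 c :=
  (shiftGraph c).toLinearPMap

/-- The spectral operator `ζ(∂_c)`. For `c = 1` the point `1` carries no mass of the resolution of
the identity of `∂_c`, so the value chosen for `ζ` at its pole does not matter here. -/
def spectralOperator (c : ℝ) : WeightedL2 c →ₗ.[ℂ] WeightedL2 c :=
  functionalCalculus (infinitesimalShift c) riemannZeta

end Shift

end SpectralOp

end

/-!
Multiplication by `e^{-ct}` followed by the Fourier transform is a unitary map from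
`L²(ℝ, e^{-2ct} dt)` to `L²(ℝ)` that turns `∂_c` into multiplication by `ξ ↦ c + 2πiξ`. Hence `∂_c`
has a resolution of the identity and its spectrum is the line `Re z = c`. For every resolution of
the identity `E`, the spectrum of `∫ f dE` is the `E`-essential range of `f`; when `f` is continuous
on the spectrum off an `E`-null set, this is the closure of the image of the remaining points. The
eigenvectors of `∂_c` would be exponentials, which are not square integrable, so `E {1} = 0` and the
value of `ζ` at its pole does not matter.
-/

noncomputable section

namespace SpectralOp

section SpectralIntegral

theorem tendsto_toLp_of_dominated {α F : Type*} [MeasurableSpace α] {μ : Measure α}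
    [NormedAddCommGroup F] {p : ℝ≥0∞} [Fact (1 ≤ p)] (hp : p ≠ ∞) {ι : Type*} {l : Filter ι}
    [l.IsCountablyGenerated] {f : α → F} {s : ι → α → F} {C : ℝ} (hf : MemLp f p μ)
    (hs : ∀ n, MemLp (s n) p μ) (hC : ∀ n, ∀ᵐ z ∂μ, ‖s n z‖ ≤ C * ‖f z‖)
    (hlim : ∀ᵐ z ∂μ, Tendsto (fun n => s n z) l (𝓝 (f z))) :
    Tendsto (fun n => (hs n).toLp) l (𝓝 hf.toLp) := by
  have hp0 : 0 < p.toReal := ENNReal.toReal_pos (zero_lt_one.trans_le Fact.out).ne' hp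
  rw [Lp.tendsto_Lp_iff_tendsto_eLpNorm'']
  simp only [eLpNorm_eq_lintegral_rpow_enorm_toReal (zero_lt_one.trans_le Fact.out).ne' hp]
  suffices h : Tendsto (fun n => ∫⁻ z, ‖(s n - f) z‖ₑ ^ p.toReal ∂μ) l (𝓝 0) by
    simpa [hp0] using h.ennrpow_const (1 / p.toReal)
  have hmajorant : ∀ n, ∀ᵐ z ∂μ, ‖(s n - f) z‖ₑ ^ p.toReal ≤ ‖(C + 1) • ‖f z‖‖ₑ ^ p.toReal := by
    intro n
    filter_upwards [hC n] with z hz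
    gcongr
    refine enorm_le_iff_norm_le.2 ((norm_sub_le _ _).trans ((?_ : _ ≤ _).trans (le_abs_self _)))
    rw [smul_eq_mul]
    linarith
  have hmajorant_fin : ∫⁻ z, ‖(C + 1) • ‖f z‖‖ₑ ^ p.toReal ∂μ < ∞ :=
    lintegral_rpow_enorm_lt_top_of_eLpNorm_lt_top (zero_lt_one.trans_le Fact.out).ne' hp
      (hf.norm.const_smul (C + 1)).eLpNorm_lt_top
  have h := tendsto_lintegral_filter_of_dominated_convergence' (l := l) (f := fun _ => 0) _
    (Eventually.of_forall fun n => ((hs n).1.sub hf.1).enorm.pow_const _)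
    (Eventually.of_forall hmajorant) hmajorant_fin.ne ?_
  · simpa using h
  · filter_upwards [hlim] with z hz
    simpa [hp0] using ((tendsto_sub_nhds_zero_iff.2 hz).enorm.ennrpow_const p.toReal)

theorem exists_simpleFunc_approx {α F : Type*} [MeasurableSpace α] [NormedAddCommGroup F]
    [MeasurableSpace F] [OpensMeasurableSpace F] [SecondCountableTopology F]
    {f : α → F} (hf : Measurable f) :
    ∃ s : ℕ → SimpleFunc α F, (∀ n z, ‖s n z‖ ≤ 2 * ‖f z‖) ∧
      ∀ z, Tendsto (fun n => s n z) atTop (𝓝 (f z)) := by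
  refine ⟨SimpleFunc.approxOn f hf Set.univ 0 (Set.mem_univ _), fun n z => ?_,
    fun z => SimpleFunc.tendsto_approxOn hf (Set.mem_univ _) (by simp)⟩
  linarith [SimpleFunc.norm_approxOn_zero_le hf (Set.mem_univ (0 : F)) z n]

theorem eLpNorm_two_sq {α F : Type*} [MeasurableSpace α] {μ : Measure α} [NormedAddCommGroup F]
    (f : α → F) : eLpNorm f 2 μ ^ 2 = ∫⁻ z, ‖f z‖ₑ ^ 2 ∂μ := by
  simpa using eLpNorm_nnreal_pow_eq_lintegral (f := f) (μ := μ) (p := 2) two_ne_zero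

theorem memLp_two_iff {α F : Type*} [MeasurableSpace α] {μ : Measure α} [NormedAddCommGroup F]
    {f : α → F} (hf : AEStronglyMeasurable f μ) :
    MemLp f 2 μ ↔ ∫⁻ z, ‖f z‖ₑ ^ 2 ∂μ < ∞ := by
  rw [← eLpNorm_two_sq, ENNReal.pow_lt_top_iff, or_iff_left two_ne_zero, MemLp, and_iff_right hf]

theorem norm_sum_sq_of_pairwise_inner_eq_zero {𝕜 H ι : Type*} [RCLike 𝕜] [NormedAddCommGroup H]
    [InnerProductSpace 𝕜 H] (t : Finset ι) {v : ι → H}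
    (h : Pairwise fun i j => inner 𝕜 (v i) (v j) = 0) :
    ‖∑ i ∈ t, v i‖ ^ 2 = ∑ i ∈ t, ‖v i‖ ^ 2 := by
  classical
  induction t using Finset.induction_on with
  | empty => simp
  | insert i t hi ih =>
    have horth : inner 𝕜 (v i) (∑ j ∈ t, v j) = 0 := by
      rw [inner_sum]
      exact Finset.sum_eq_zero fun j hj => h (ne_of_mem_of_not_mem hj hi).symm
    rw [Finset.sum_insert hi, Finset.sum_insert hi, ← ih]
    simpa only [sq] using norm_add_sq_eq_norm_sq_add_norm_sq_of_inner_eq_zero (𝕜 := 𝕜) _ _ horth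

variable {H : Type*} [NormedAddCommGroup H] [InnerProductSpace ℂ H] [CompleteSpace H]

namespace ResolutionOfIdentity

variable (E : ResolutionOfIdentity H)

/-- The `H`-valued measure `B ↦ E(B) x`. -/
def vectorMeasure (x : H) : VectorMeasure ℂ H where
  measureOf' B := E.proj B x
  empty' := by simp [E.proj_empty]
  not_measurable' B hB := by simp [E.not_measurable B hB]
  m_iUnion' _ hB hd := E.iUnion _ hB hd x

theorem proj_union {B C : Set ℂ} (hB : MeasurableSet B) (hC : MeasurableSet C)
    (h : Disjoint B C) : E.proj (B ∪ C) = E.proj B + E.proj C :=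
  ContinuousLinearMap.ext fun x => (E.vectorMeasure x).of_union h hB hC

theorem proj_proj {B C : Set ℂ} (hB : MeasurableSet B) (hC : MeasurableSet C) (x : H) :
    E.proj B (E.proj C x) = E.proj (B ∩ C) x := by
  rw [E.inter B C hB hC]; rfl

theorem inner_proj_of_disjoint {B C : Set ℂ} (hB : MeasurableSet B) (hC : MeasurableSet C)
    (h : Disjoint B C) (x y : H) : inner ℂ (E.proj B x) (E.proj C y) = 0 := by
  rw [(E.isStarProjection B hB).isSelfAdjoint.isSymmetric.apply_clm, E.proj_proj hB hC, h.inter_eq,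
    E.proj_empty, zero_apply, inner_zero_right]

theorem measure_apply_eq_enorm_sq (x : H) {B : Set ℂ} (hB : MeasurableSet B) :
    E.measure x B = ‖E.proj B x‖ₑ ^ 2 := by
  rw [E.measure_apply x hB, ENNReal.ofReal_pow (norm_nonneg _), ofReal_norm]

theorem measure_univ (x : H) : E.measure x Set.univ = ‖x‖ₑ ^ 2 := by
  rw [E.measure_apply_eq_enorm_sq x MeasurableSet.univ, E.univ, one_apply_eq_self]

instance isFiniteMeasure_measure (x : H) : IsFiniteMeasure (E.measure x) :=
  ⟨by rw [E.measure_univ]; exact ENNReal.pow_lt_top enorm_lt_top⟩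

/-- The set function `B ↦ (z ↦ z • E(B))`, through which the integral of simple functions is an
instance of `SimpleFunc.setToSimpleFunc`. -/
def weighted (B : Set ℂ) : ℂ →L[ℝ] (H →L[ℂ] H) :=
  (ContinuousLinearMap.toSpanSingleton ℂ (E.proj B)).restrictScalars ℝ

theorem finMeasAdditive_weighted : FinMeasAdditive (0 : Measure ℂ) E.weighted := by
  intro B C hB hC _ _ h
  ext z : 1
  simp [weighted, E.proj_union hB hC h, smul_add]

theorem simpleIntegral_eq_setToSimpleFunc (s : SimpleFunc ℂ ℂ) :
    E.simpleIntegral s = SimpleFunc.setToSimpleFunc E.weighted s := by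
  simp [simpleIntegral, SimpleFunc.setToSimpleFunc, weighted]

theorem simpleIntegral_add (s t : SimpleFunc ℂ ℂ) :
    E.simpleIntegral (s + t) = E.simpleIntegral s + E.simpleIntegral t := by
  simp only [simpleIntegral_eq_setToSimpleFunc]
  exact SimpleFunc.setToSimpleFunc_add _ E.finMeasAdditive_weighted integrable_zero_measure
    integrable_zero_measure

theorem simpleIntegral_indicator (a : ℂ) {B : Set ℂ} (hB : MeasurableSet B) :
    E.simpleIntegral (SimpleFunc.piecewise B hB (SimpleFunc.const ℂ a) (SimpleFunc.const ℂ 0)) =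
      a • E.proj B := by
  rw [simpleIntegral_eq_setToSimpleFunc, SimpleFunc.setToSimpleFunc_indicator _ _ hB]
  · simp [weighted]
  · simp [weighted, E.proj_empty]

theorem simpleIntegral_const (a : ℂ) : E.simpleIntegral (SimpleFunc.const ℂ a) = a • 1 := by
  have h := E.simpleIntegral_indicator a MeasurableSet.univ
  rwa [SimpleFunc.piecewise_univ, E.univ] at h

theorem simpleIntegral_mul (s t : SimpleFunc ℂ ℂ) :
    E.simpleIntegral (s * t) = E.simpleIntegral s * E.simpleIntegral t := by
  induction s using SimpleFunc.induction with
  | @const a B hB =>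
    induction t using SimpleFunc.induction with
    | @const b C hC =>
      have h : SimpleFunc.piecewise B hB (SimpleFunc.const ℂ a) (SimpleFunc.const ℂ 0) *
          SimpleFunc.piecewise C hC (SimpleFunc.const ℂ b) (SimpleFunc.const ℂ 0) =
          SimpleFunc.piecewise (B ∩ C) (hB.inter hC) (SimpleFunc.const ℂ (a * b))
            (SimpleFunc.const ℂ 0) := by
        ext z
        by_cases h1 : z ∈ B <;> by_cases h2 : z ∈ C <;> simp [h1, h2]
      rw [h, simpleIntegral_indicator, simpleIntegral_indicator, simpleIntegral_indicator,
        E.inter B C hB hC, smul_mul_smul_comm]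
    | add _ hf hg => rw [mul_add, simpleIntegral_add, hf, hg, simpleIntegral_add, mul_add]
  | add _ hf hg => rw [add_mul, simpleIntegral_add, hf, hg, simpleIntegral_add, add_mul]

theorem simpleIntegral_smul (a : ℂ) (s : SimpleFunc ℂ ℂ) :
    E.simpleIntegral (a • s) = a • E.simpleIntegral s := by
  rw [show a • s = SimpleFunc.const ℂ a * s by ext; simp, simpleIntegral_mul, simpleIntegral_const,
    smul_one_mul]

theorem enorm_simpleIntegral (s : SimpleFunc ℂ ℂ) (x : H) :
    ‖E.simpleIntegral s x‖ₑ = eLpNorm s 2 (E.measure x) := by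
  have horth : Pairwise fun z w : ℂ =>
      inner ℂ (z • E.proj (s ⁻¹' {z}) x) (w • E.proj (s ⁻¹' {w}) x) = 0 := by
    intro z w hzw
    rw [inner_smul_left, inner_smul_right, E.inner_proj_of_disjoint (s.measurableSet_fiber z)
      (s.measurableSet_fiber w) (Disjoint.preimage _ (Set.disjoint_singleton.2 hzw)), mul_zero,
      mul_zero]
  apply (ENNReal.pow_right_strictMono two_ne_zero).injective
  dsimp only
  rw [eLpNorm_two_sq]
  calc ‖E.simpleIntegral s x‖ₑ ^ 2
      = ∑ z ∈ s.range, ‖z • E.proj (s ⁻¹' {z}) x‖ₑ ^ 2 := by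
        simp only [← ofReal_norm, ← ENNReal.ofReal_pow (norm_nonneg _)]
        rw [simpleIntegral, _root_.sum_apply, ← ENNReal.ofReal_sum_of_nonneg (by simp),
          ← norm_sum_sq_of_pairwise_inner_eq_zero _ horth]
        rfl
    _ = ∑ z ∈ s.range, ‖z‖ₑ ^ 2 * E.measure x (s ⁻¹' {z}) := by
        refine Finset.sum_congr rfl fun z _ => ?_
        rw [E.measure_apply_eq_enorm_sq x (s.measurableSet_fiber z), enorm_smul, mul_pow]
    _ = ∫⁻ z, ‖s z‖ₑ ^ 2 ∂(E.measure x) := by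
        rw [← SimpleFunc.map_lintegral (fun z : ℂ => ‖z‖ₑ ^ 2) s,
          ← SimpleFunc.lintegral_eq_lintegral]
        rfl

/-- The inclusion of the simple functions into `L²(⟨E x, x⟩)`. -/
def simpleToLp (x : H) : SimpleFunc ℂ ℂ →ₗ[ℂ] Lp ℂ 2 (E.measure x) where
  toFun s := (s.memLp_of_isFiniteMeasure 2 (E.measure x)).toLp
  map_add' _ _ := MemLp.toLp_add _ _
  map_smul' _ _ := MemLp.toLp_const_smul _ _

theorem denseRange_simpleToLp (x : H) : DenseRange (E.simpleToLp x) := by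
  refine (Lp.simpleFunc.denseRange (p := 2) ENNReal.ofNat_ne_top).mono ?_
  rintro _ ⟨s, rfl⟩
  exact ⟨Lp.simpleFunc.toSimpleFunc s, congrArg Subtype.val (Lp.simpleFunc.toLp_toSimpleFunc s)⟩

theorem norm_simpleIntegral (s : SimpleFunc ℂ ℂ) (x : H) :
    ‖E.simpleIntegral s x‖ = ‖E.simpleToLp x s‖ := by
  rw [← toReal_enorm, E.enorm_simpleIntegral]
  exact (Lp.norm_toLp s (s.memLp_of_isFiniteMeasure 2 (E.measure x))).symm

/-- The map `s ↦ (∫ s dE) x` on simple functions. -/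
def simpleVectorIntegral (x : H) : SimpleFunc ℂ ℂ →ₗ[ℂ] H where
  toFun s := E.simpleIntegral s x
  map_add' s t := by rw [E.simpleIntegral_add, add_apply]
  map_smul' a s := by rw [E.simpleIntegral_smul]; rfl

/-- The isometric extension `f ↦ (∫ f dE) x` to `L²(⟨E x, x⟩)` of the integral of simple
functions. -/
def vectorIntegral (x : H) : Lp ℂ 2 (E.measure x) →ₗᵢ[ℂ] H where
  toLinearMap := ((E.simpleVectorIntegral x).extendOfNorm (E.simpleToLp x)).toLinearMap
  norm_map' := by
    refine isClosed_property (E.denseRange_simpleToLp x) (isClosed_eq ?_ continuous_norm)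
      fun s => ?_
    · exact ((E.simpleVectorIntegral x).extendOfNorm (E.simpleToLp x)).continuous.norm
    · exact (congrArg norm (LinearMap.extendOfNorm_eq (E.denseRange_simpleToLp x)
        ⟨1, fun s => by rw [one_mul]; exact (E.norm_simpleIntegral s x).le⟩ s)).trans
          (E.norm_simpleIntegral s x)

theorem vectorIntegral_toLp_simpleFunc (s : SimpleFunc ℂ ℂ) (x : H)
    (hs : MemLp s 2 (E.measure x)) : E.vectorIntegral x hs.toLp = E.simpleIntegral s x :=
  LinearMap.extendOfNorm_eq (E.denseRange_simpleToLp x)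
    ⟨1, fun s => by rw [one_mul]; exact (E.norm_simpleIntegral s x).le⟩ s

variable {E} {f g : ℂ → ℂ} {x y y' w : H}

theorem mem_integralGraph_iff (hf : Measurable f) :
    (x, y) ∈ E.integralGraph f ↔
      ∃ h : MemLp f 2 (E.measure x), E.vectorIntegral x h.toLp = y := by
  have htendsto : ∀ (h : MemLp f 2 (E.measure x)) (s : ℕ → SimpleFunc ℂ ℂ) (C : ℝ),
      (∀ n z, ‖s n z‖ ≤ C * ‖f z‖) → (∀ z, Tendsto (fun n => s n z) atTop (𝓝 (f z))) →
      Tendsto (fun n => E.simpleIntegral (s n) x) atTop (𝓝 (E.vectorIntegral x h.toLp)) := by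
    intro h s C hC hs
    have hLp := tendsto_toLp_of_dominated ENNReal.ofNat_ne_top h
      (fun n => (s n).memLp_of_isFiniteMeasure 2 (E.measure x)) (fun n => ae_of_all _ (hC n))
      (ae_of_all _ hs)
    simpa only [Function.comp_def, vectorIntegral_toLp_simpleFunc]
      using ((E.vectorIntegral x).continuous.tendsto _).comp hLp
  constructor
  · rintro ⟨hfin, hy⟩
    obtain ⟨s, hC, hs⟩ := exists_simpleFunc_approx hf
    have h := (memLp_two_iff hf.aestronglyMeasurable).2 hfin
    exact ⟨h, tendsto_nhds_unique (htendsto h s 2 hC hs) (hy s 2 hC hs)⟩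
  · rintro ⟨h, rfl⟩
    exact ⟨(memLp_two_iff hf.aestronglyMeasurable).1 h, htendsto h⟩

theorem memLp_of_mem_integralGraph (hf : Measurable f) (h : (x, y) ∈ E.integralGraph f) :
    MemLp f 2 (E.measure x) :=
  ((mem_integralGraph_iff hf).1 h).1

theorem exists_mem_integralGraph (hf : Measurable f) (h : MemLp f 2 (E.measure x)) :
    ∃ y, (x, y) ∈ E.integralGraph f :=
  ⟨_, (mem_integralGraph_iff hf).2 ⟨h, rfl⟩⟩

theorem eq_of_mem_integralGraph (hf : Measurable f) (h : (x, y) ∈ E.integralGraph f)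
    (h' : (x, y') ∈ E.integralGraph f) : y = y' := by
  obtain ⟨_, rfl⟩ := (mem_integralGraph_iff hf).1 h
  obtain ⟨_, rfl⟩ := (mem_integralGraph_iff hf).1 h'
  rfl

theorem enorm_of_mem_integralGraph (hf : Measurable f) (h : (x, y) ∈ E.integralGraph f) :
    ‖y‖ₑ = eLpNorm f 2 (E.measure x) := by
  obtain ⟨hf2, rfl⟩ := (mem_integralGraph_iff hf).1 h
  rw [← Lp.enorm_toLp hf2]
  exact (E.vectorIntegral x).enorm_map _

theorem mem_integralGraph_congr_ae (hf : Measurable f) (hg : Measurable g)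
    (hfg : f =ᵐ[E.measure x] g) (h : (x, y) ∈ E.integralGraph f) : (x, y) ∈ E.integralGraph g := by
  obtain ⟨hf2, rfl⟩ := (mem_integralGraph_iff hf).1 h
  exact (mem_integralGraph_iff hg).2 ⟨(memLp_congr_ae hfg).1 hf2,
    congrArg _ ((MemLp.toLp_eq_toLp_iff _ _).2 hfg.symm)⟩

theorem add_mem_integralGraph (hf : Measurable f) (hg : Measurable g)
    (h : (x, y) ∈ E.integralGraph f) (h' : (x, y') ∈ E.integralGraph g) :
    (x, y + y') ∈ E.integralGraph (f + g) := by
  obtain ⟨hf2, rfl⟩ := (mem_integralGraph_iff hf).1 h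
  obtain ⟨hg2, rfl⟩ := (mem_integralGraph_iff hg).1 h'
  exact (mem_integralGraph_iff (hf.add hg)).2 ⟨hf2.add hg2, by rw [MemLp.toLp_add, map_add]⟩

theorem sub_mem_integralGraph (hf : Measurable f) (hg : Measurable g)
    (h : (x, y) ∈ E.integralGraph f) (h' : (x, y') ∈ E.integralGraph g) :
    (x, y - y') ∈ E.integralGraph (f - g) := by
  obtain ⟨hf2, rfl⟩ := (mem_integralGraph_iff hf).1 h
  obtain ⟨hg2, rfl⟩ := (mem_integralGraph_iff hg).1 h'
  exact (mem_integralGraph_iff (hf.sub hg)).2 ⟨hf2.sub hg2, by rw [MemLp.toLp_sub, map_sub]⟩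

theorem const_smul_mem_integralGraph (hf : Measurable f) (a : ℂ) (h : (x, y) ∈ E.integralGraph f) :
    (x, a • y) ∈ E.integralGraph (a • f) := by
  obtain ⟨hf2, rfl⟩ := (mem_integralGraph_iff hf).1 h
  exact (mem_integralGraph_iff (hf.const_smul a)).2
    ⟨hf2.const_smul a, by rw [MemLp.toLp_const_smul, map_smul]⟩

variable (E) in
theorem simpleFunc_mem_integralGraph (s : SimpleFunc ℂ ℂ) (x : H) :
    (x, E.simpleIntegral s x) ∈ E.integralGraph s :=
  (mem_integralGraph_iff s.measurable).2
    ⟨s.memLp_of_isFiniteMeasure 2 _, E.vectorIntegral_toLp_simpleFunc s x _⟩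

variable (E) in
theorem const_mem_integralGraph (a : ℂ) (x : H) : (x, a • x) ∈ E.integralGraph fun _ => a := by
  simpa [simpleIntegral_const] using! E.simpleFunc_mem_integralGraph (SimpleFunc.const ℂ a) x

theorem simpleIntegral_mem_integralGraph (hf : Measurable f) (t : SimpleFunc ℂ ℂ)
    (h : (x, y) ∈ E.integralGraph f) :
    (x, E.simpleIntegral t y) ∈ E.integralGraph (⇑t * f) := by
  obtain ⟨s, hC, hs⟩ := exists_simpleFunc_approx hf
  obtain ⟨K, hK⟩ := t.exists_forall_norm_le
  have htf : Measurable (⇑t * f) := t.measurable.mul hf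
  obtain ⟨w, hw⟩ := exists_mem_integralGraph htf <|
    (memLp_of_mem_integralGraph hf h).of_le_mul htf.aestronglyMeasurable <| ae_of_all _ fun z => by
      rw [Pi.mul_apply, norm_mul]
      exact mul_le_mul_of_nonneg_right (hK z) (norm_nonneg _)
  have hlim : Tendsto (fun n => E.simpleIntegral t (E.simpleIntegral (s n) x)) atTop (𝓝 w) := by
    simpa only [simpleIntegral_mul] using! hw.2 (fun n => t * s n) 2
      (fun n z => by
        simpa [mul_left_comm] using mul_le_mul_of_nonneg_left (hC n z) (norm_nonneg (t z)))
      (fun z => by simpa using (hs z).const_mul (t z))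
  have hlim' := ((E.simpleIntegral t).continuous.tendsto _).comp (h.2 s 2 hC hs)
  rwa [tendsto_nhds_unique hlim' hlim]

theorem measure_eq_withDensity_of_mem_integralGraph (hf : Measurable f)
    (h : (x, y) ∈ E.integralGraph f) :
    E.measure y = (E.measure x).withDensity fun z => ‖f z‖ₑ ^ 2 := by
  refine Measure.ext fun B hB => ?_
  have hindicator := simpleIntegral_mem_integralGraph hf
    (SimpleFunc.piecewise B hB (SimpleFunc.const ℂ 1) (SimpleFunc.const ℂ 0)) h
  rw [simpleIntegral_indicator, one_smul] at hindicator
  rw [E.measure_apply_eq_enorm_sq y hB, enorm_of_mem_integralGraph ?_ hindicator, eLpNorm_two_sq,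
    withDensity_apply _ hB, ← lintegral_indicator hB]
  · refine lintegral_congr fun z => ?_
    by_cases hz : z ∈ B <;> simp [hz]
  · exact (SimpleFunc.measurable _).mul hf

theorem mem_integralGraph_of_mul (hf : Measurable f) (hg : Measurable g)
    (h : (x, y) ∈ E.integralGraph g) (h' : (x, w) ∈ E.integralGraph (f * g)) :
    (y, w) ∈ E.integralGraph f := by
  have hfg : Measurable (f * g) := hf.mul hg
  refine ⟨?_, fun s C hC hs => ?_⟩
  · rw [measure_eq_withDensity_of_mem_integralGraph hg h, lintegral_withDensity_eq_lintegral_mul _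
      (hg.enorm.pow_const 2) (hf.enorm.pow_const 2)]
    simpa [mul_pow, mul_comm] using h'.1
  · have hsg : ∀ n, (x, E.simpleIntegral (s n) y) ∈ E.integralGraph (⇑(s n) * g) :=
      fun n => simpleIntegral_mem_integralGraph hg (s n) h
    choose hsg2 hsg using fun n => (mem_integralGraph_iff ((s n).measurable.mul hg)).1 (hsg n)
    obtain ⟨hfg2, rfl⟩ := (mem_integralGraph_iff hfg).1 h'
    simp only [← hsg]
    refine ((E.vectorIntegral x).continuous.tendsto _).comp (tendsto_toLp_of_dominated (C := C)
      ENNReal.ofNat_ne_top hfg2 hsg2 (fun n => ae_of_all _ fun z => ?_)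
      (ae_of_all _ fun z => (hs z).mul_const _))
    simpa [mul_assoc] using mul_le_mul_of_nonneg_right (hC n z) (norm_nonneg (g z))

theorem mem_graph_integral_iff (hf : Measurable f) {p : H × H} :
    p ∈ (E.integral f).graph ↔ p ∈ E.integralGraph f := by
  rw [integral, Submodule.toLinearPMap_graph_eq]
  rintro ⟨x, y⟩ h rfl
  exact eq_of_mem_integralGraph hf h (E.integralGraph f).zero_mem

end ResolutionOfIdentity

end SpectralIntegral

section Spectrum

theorem inResolventSet_iff_graph {H : Type*} [NormedAddCommGroup H] [InnerProductSpace ℂ H]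
    {A : H →ₗ.[ℂ] H} {z : ℂ} :
    InResolventSet A z ↔ ∃ R : H →L[ℂ] H, (∀ u, (R u, u + z • R u) ∈ A.graph) ∧
      ∀ v w, (v, w) ∈ A.graph → R (w - z • v) = v := by
  refine exists_congr fun R => and_congr (forall_congr' fun u => ?_) ?_ <;>
    simp only [LinearPMap.mem_graph_iff]
  · refine exists_congr fun v => and_congr_right fun hv => ?_
    rw [hv, sub_eq_iff_eq_add]
  · exact ⟨fun h v w ⟨v', hv, hw⟩ => by rw [← hv, ← hw]; exact h v',
      fun h v => h v (A v) ⟨v, rfl, rfl⟩⟩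

theorem mem_opSpectrum_of_approx_eigenvector {H : Type*} [NormedAddCommGroup H]
    [InnerProductSpace ℂ H] {A : H →ₗ.[ℂ] H} {a : ℂ}
    (h : ∀ ε > 0, ∃ x y : H, (x, y) ∈ A.graph ∧ x ≠ 0 ∧ ‖y - a • x‖ ≤ ε * ‖x‖) :
    a ∈ opSpectrum A := by
  intro ha
  obtain ⟨R, -, hR⟩ := inResolventSet_iff_graph.1 ha
  obtain ⟨x, y, hxy, hx, hle⟩ := h (‖R‖ + 1)⁻¹ (by positivity)
  have hx0 : 0 < ‖x‖ := norm_pos_iff.2 hx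
  have hlt : ‖R‖ * (‖R‖ + 1)⁻¹ < 1 := by
    rw [← div_eq_mul_inv, div_lt_one (by positivity)]
    exact lt_add_one _
  have : ‖x‖ < ‖x‖ :=
    calc ‖x‖ = ‖R (y - a • x)‖ := by rw [hR x y hxy]
      _ ≤ ‖R‖ * ((‖R‖ + 1)⁻¹ * ‖x‖) := R.le_opNorm_of_le hle
      _ = (‖R‖ * (‖R‖ + 1)⁻¹) * ‖x‖ := (mul_assoc _ _ _).symm
      _ < 1 * ‖x‖ := mul_lt_mul_of_pos_right hlt hx0
      _ = ‖x‖ := one_mul _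
  exact this.false

variable {H : Type*} [NormedAddCommGroup H] [InnerProductSpace ℂ H] [CompleteSpace H]

namespace ResolutionOfIdentity

variable {E : ResolutionOfIdentity H} {f g : ℂ → ℂ} {x y : H} {a : ℂ} {B C : Set ℂ}

theorem norm_le_of_mem_integralGraph (hf : Measurable f) {K : ℝ} (hK : 0 ≤ K)
    (hfK : ∀ᵐ z ∂(E.measure x), ‖f z‖ ≤ K) (h : (x, y) ∈ E.integralGraph f) :
    ‖y‖ ≤ K * ‖x‖ := by
  have hy : ‖y‖ₑ ≤ ‖x‖ₑ * ENNReal.ofReal K := by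
    rw [enorm_of_mem_integralGraph hf h]
    refine (eLpNorm_le_of_ae_bound hfK).trans_eq ?_
    rw [E.measure_univ, ← ENNReal.rpow_natCast, ← ENNReal.rpow_mul]
    norm_num
  rw [← ofReal_norm, ← ofReal_norm, ← ENNReal.ofReal_mul (norm_nonneg _),
    ENNReal.ofReal_le_ofReal_iff (by positivity)] at hy
  rwa [mul_comm]

theorem exists_clm_mem_integralGraph (hg : Measurable g) {K : ℝ} (hgK : ∀ z, ‖g z‖ ≤ K) :
    ∃ R : H →L[ℂ] H, ∀ x, (x, R x) ∈ E.integralGraph g := by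
  have hex (x : H) : ∃ y, (x, y) ∈ E.integralGraph g :=
    exists_mem_integralGraph hg (MemLp.of_bound hg.aestronglyMeasurable K (ae_of_all _ hgK))
  choose R hR using hex
  have map_add (x y : H) : R (x + y) = R x + R y := by
    refine eq_of_mem_integralGraph hg (hR (x + y)) ?_
    have := (E.integralGraph g).add_mem (hR x) (hR y)
    rwa [Prod.mk_add_mk] at this
  have map_smul (a : ℂ) (x : H) : R (a • x) = a • R x := by
    refine eq_of_mem_integralGraph hg (hR (a • x)) ?_
    have := (E.integralGraph g).smul_mem a (hR x)
    rwa [Prod.smul_mk] at this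
  exact ⟨LinearMap.mkContinuous ⟨⟨R, map_add⟩, map_smul⟩ K fun x =>
    norm_le_of_mem_integralGraph hg ((norm_nonneg _).trans (hgK 0)) (ae_of_all _ hgK) (hR x), hR⟩

theorem proj_eq_zero_iff (hB : MeasurableSet B) : E.proj B = 0 ↔ ∀ x, E.measure x B = 0 := by
  simp [ContinuousLinearMap.ext_iff, E.measure_apply_eq_enorm_sq _ hB]

theorem proj_eq_zero_of_subset (hB : MeasurableSet B) (hC : MeasurableSet C) (h : B ⊆ C)
    (h0 : E.proj C = 0) : E.proj B = 0 := by
  rw [← Set.inter_eq_left.2 h, E.inter B C hB hC, h0, mul_zero]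

theorem ae_mem_of_proj_eq_self (hB : MeasurableSet B) (hx : E.proj B x = x) :
    ∀ᵐ z ∂(E.measure x), z ∈ B := by
  change E.measure x Bᶜ = 0
  rw [E.measure_apply_eq_enorm_sq x hB.compl, ← hx, E.proj_proj hB.compl hB, Set.compl_inter_self,
    E.proj_empty, zero_apply, enorm_zero, zero_pow two_ne_zero]

theorem exists_ne_zero_proj_eq_self (hB : MeasurableSet B) (h : E.proj B ≠ 0) :
    ∃ x ≠ 0, E.proj B x = x := by
  obtain ⟨u, hu⟩ := ContinuousLinearMap.exists_ne_zero h
  exact ⟨E.proj B u, hu, by rw [E.proj_proj hB hB, Set.inter_self]⟩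

theorem exists_mem_integralGraph_norm_sub_le (hf : Measurable f) {ε : ℝ} (hε : 0 ≤ ε)
    (hx : ∀ᵐ z ∂(E.measure x), ‖f z - a‖ ≤ ε) :
    ∃ y, (x, y) ∈ E.integralGraph f ∧ ‖y - a • x‖ ≤ ε * ‖x‖ := by
  obtain ⟨y, hy⟩ := exists_mem_integralGraph (hf.sub_const a)
    (MemLp.of_bound (hf.sub_const a).aestronglyMeasurable ε hx)
  refine ⟨y + a • x, ?_, ?_⟩
  · simpa [Pi.add_def] using
      add_mem_integralGraph (hf.sub_const a) measurable_const hy (E.const_mem_integralGraph a x)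
  · rw [add_sub_cancel_right]
    exact norm_le_of_mem_integralGraph (hf.sub_const a) hε hx hy

theorem inResolventSet_integral_of_ae_inv (hf : Measurable f) (hg : Measurable g) {K : ℝ}
    (hgK : ∀ z, ‖g z‖ ≤ K) (hfg : ∀ x, ∀ᵐ z ∂(E.measure x), (f z - a) * g z = 1) :
    InResolventSet (E.integral f) a := by
  have one_mem (x : H) : (x, x) ∈ E.integralGraph fun _ => 1 := by
    simpa using E.const_mem_integralGraph 1 x
  obtain ⟨R, hR⟩ := exists_clm_mem_integralGraph (E := E) hg hgK
  refine inResolventSet_iff_graph.2 ⟨R, fun u => ?_, fun v w hvw => ?_⟩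
  · refine (mem_graph_integral_iff hf).2 (mem_integralGraph_of_mul hf hg (hR u) ?_)
    refine mem_integralGraph_congr_ae (measurable_const.add (hg.const_smul a)) (hf.mul hg) ?_
      (add_mem_integralGraph measurable_const (hg.const_smul a) (one_mem u)
        (const_smul_mem_integralGraph hg a (hR u)))
    filter_upwards [hfg u] with z hz
    simp only [Pi.add_apply, Pi.smul_apply, Pi.mul_apply, smul_eq_mul]
    linear_combination -hz
  · have hf_sub : (v, w - a • v) ∈ E.integralGraph (f - fun _ => a) :=
      sub_mem_integralGraph hf measurable_const ((mem_graph_integral_iff hf).1 hvw)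
        (E.const_mem_integralGraph a v)
    have hf_sub_meas : Measurable (f - fun _ => a) := hf.sub_const a
    refine eq_of_mem_integralGraph hg (hR _) (mem_integralGraph_of_mul hg hf_sub_meas hf_sub ?_)
    refine mem_integralGraph_congr_ae measurable_const (hg.mul hf_sub_meas) ?_ (one_mem v)
    filter_upwards [hfg v] with z hz
    rw [Pi.mul_apply, Pi.sub_apply, mul_comm, hz]

theorem inResolventSet_integral (hf : Measurable f) {ε : ℝ} (hε : 0 < ε)
    (h : E.proj (f ⁻¹' Metric.ball a ε) = 0) : InResolventSet (E.integral f) a := by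
  have hN : MeasurableSet (f ⁻¹' Metric.ball a ε) := hf Metric.isOpen_ball.measurableSet
  refine inResolventSet_integral_of_ae_inv (K := ε⁻¹)
    (g := (f ⁻¹' Metric.ball a ε)ᶜ.indicator fun z => (f z - a)⁻¹) hf
    ((hf.sub_const a).inv.indicator hN.compl) (fun z => ?_) fun x => ?_
  · rw [norm_indicator_eq_indicator_norm]
    refine Set.indicator_apply_le' (fun hz => ?_) fun _ => inv_nonneg.2 hε.le
    rw [norm_inv]
    exact inv_anti₀ hε (by simpa [dist_eq_norm] using hz)
  · filter_upwards [measure_eq_zero_iff_ae_notMem.1 ((proj_eq_zero_iff hN).1 h x)] with z hz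
    have hne : f z - a ≠ 0 := fun h0 => hz <| by
      rw [Set.mem_preimage, sub_eq_zero.1 h0]
      exact Metric.mem_ball_self hε
    rw [Set.indicator_of_mem (by exact hz), mul_inv_cancel₀ hne]

theorem opSpectrum_integral (hf : Measurable f) :
    opSpectrum (E.integral f) = {a | ∀ ε > 0, E.proj (f ⁻¹' Metric.ball a ε) ≠ 0} := by
  ext a
  refine ⟨fun h ε hε h0 => h (inResolventSet_integral hf hε h0), fun h =>
    mem_opSpectrum_of_approx_eigenvector fun ε hε => ?_⟩
  have hN : MeasurableSet (f ⁻¹' Metric.ball a ε) := hf Metric.isOpen_ball.measurableSet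
  obtain ⟨x, hx, hx_self⟩ := exists_ne_zero_proj_eq_self hN (h ε hε)
  have hxε : ∀ᵐ z ∂(E.measure x), ‖f z - a‖ ≤ ε := by
    filter_upwards [ae_mem_of_proj_eq_self hN hx_self] with z hz
    exact (mem_ball_iff_norm.1 hz).le
  obtain ⟨y, hy, hle⟩ := exists_mem_integralGraph_norm_sub_le hf hε.le hxε
  exact ⟨x, y, (mem_graph_integral_iff hf).2 hy, hx, hle⟩

theorem proj_singleton_eq_zero_iff {A : H →ₗ.[ℂ] H} (hE : IsResolutionOf E A) {z : ℂ} :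
    E.proj {z} = 0 ↔ ∀ x, (x, z • x) ∈ A.graph → x = 0 := by
  have hz : MeasurableSet {z} := measurableSet_singleton z
  rw [← hE]
  simp only [mem_graph_integral_iff measurable_id]
  constructor
  · intro h0 x hx
    have hzero : (x, 0) ∈ E.integralGraph (id - fun _ => z) := by
      simpa using sub_mem_integralGraph measurable_id measurable_const hx
        (E.const_mem_integralGraph z x)
    have hid : Measurable (id - fun _ : ℂ => z) := measurable_id.sub_const z
    have hae : (id - fun _ => z) =ᵐ[E.measure x] 0 :=
      (eLpNorm_eq_zero_iff hid.aestronglyMeasurable two_ne_zero).1 <| by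
        rw [← enorm_of_mem_integralGraph hid hzero, enorm_zero]
    have huniv : E.measure x Set.univ = 0 := by
      rw [← Set.union_compl_self {z}]
      refine measure_union_null ((proj_eq_zero_iff hz).1 h0 x) (measure_mono_null ?_ hae)
      exact fun w hw h => hw (sub_eq_zero.1 h)
    simpa [E.measure_univ] using huniv
  · intro h
    by_contra h0
    obtain ⟨x, hx, hxz⟩ := exists_ne_zero_proj_eq_self hz h0
    refine hx (h x (mem_integralGraph_congr_ae measurable_const measurable_id ?_
      (E.const_mem_integralGraph z x)))
    filter_upwards [ae_mem_of_proj_eq_self hz hxz] with w hw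
    exact (Set.mem_singleton_iff.1 hw).symm

theorem proj_eq_zero_of_countable (hB : B.Countable) (h : ∀ z ∈ B, E.proj {z} = 0) :
    E.proj B = 0 := by
  refine (proj_eq_zero_iff hB.measurableSet).2 fun x => ?_
  rw [← Set.biUnion_of_singleton B]
  exact (measure_biUnion_null_iff hB).2 fun z hz =>
    (proj_eq_zero_iff (measurableSet_singleton z)).1 (h z hz) x

theorem mem_opSpectrum_iff {A : H →ₗ.[ℂ] H} (hE : IsResolutionOf E A) :
    a ∈ opSpectrum A ↔ ∀ ε > 0, E.proj (Metric.ball a ε) ≠ 0 := by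
  rw [← hE, opSpectrum_integral measurable_id]
  rfl

theorem measure_compl_opSpectrum {A : H →ₗ.[ℂ] H} (hE : IsResolutionOf E A) (x : H) :
    E.measure x (opSpectrum A)ᶜ = 0 := by
  refine measure_null_of_locally_null _ fun a ha => ?_
  rw [Set.mem_compl_iff, mem_opSpectrum_iff hE] at ha
  push Not at ha
  obtain ⟨ε, hε, h0⟩ := ha
  exact ⟨Metric.ball a ε, mem_nhdsWithin_of_mem_nhds (Metric.ball_mem_nhds a hε),
    (proj_eq_zero_iff measurableSet_ball).1 h0 x⟩

theorem opSpectrum_integral_eq_closure_image {A : H →ₗ.[ℂ] H} (hE : IsResolutionOf E A)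
    (hf : Measurable f) {N : Set ℂ} (hN : MeasurableSet N) (hN0 : E.proj N = 0)
    (hcont : ∀ s ∈ opSpectrum A \ N, ContinuousAt f s) :
    opSpectrum (E.integral f) = closure (f '' (opSpectrum A \ N)) := by
  ext a
  rw [opSpectrum_integral hf, Set.mem_ofPred_eq, Metric.mem_closure_iff]
  refine forall₂_congr fun ε _ => ?_
  have hpre : MeasurableSet (f ⁻¹' Metric.ball a ε) := hf measurableSet_ball
  constructor
  · contrapose!
    intro hfar
    refine (proj_eq_zero_iff hpre).2 fun x => measure_mono_null (t := (opSpectrum A)ᶜ ∪ N) ?_ <|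
      measure_union_null (measure_compl_opSpectrum hE x) ((proj_eq_zero_iff hN).1 hN0 x)
    intro s hs
    by_contra hs'
    rw [Set.mem_union, not_or, Set.notMem_compl_iff] at hs'
    exact (hfar (f s) (Set.mem_image_of_mem f hs')).not_gt (Metric.mem_ball'.1 hs)
  · rintro ⟨_, ⟨s, hs, rfl⟩, hdist⟩ h0
    obtain ⟨δ, hδ, hsub⟩ := Metric.mem_nhds_iff.1
      (hcont s hs (Metric.isOpen_ball.mem_nhds (Metric.mem_ball'.2 hdist)))
    exact (mem_opSpectrum_iff hE).1 hs.1 δ hδ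
      (proj_eq_zero_of_subset measurableSet_ball hpre hsub h0)

theorem integralGraph_eq_of_le (hf : Measurable f) {G : Submodule ℂ (H × H)}
    (hle : E.integralGraph f ≤ G) (ha : InResolventSet (E.integral f) a)
    (hG : ∀ x, (x, a • x) ∈ G → x = 0) : E.integralGraph f = G := by
  refine le_antisymm hle ?_
  rintro ⟨x, y⟩ hxy
  obtain ⟨R, hR, -⟩ := inResolventSet_iff_graph.1 ha
  set u := y - a • x
  have hRu : (R u, u + a • R u) ∈ E.integralGraph f := (mem_graph_integral_iff hf).1 (hR u)
  have hsub : y - (u + a • R u) = a • (x - R u) := by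
    simp only [u, smul_sub]
    abel
  have hx : x - R u = 0 := hG _ (hsub ▸ G.sub_mem hxy (hle hRu))
  rw [hx, smul_zero] at hsub
  rwa [← sub_eq_zero.1 hsub, ← sub_eq_zero.1 hx] at hRu

end ResolutionOfIdentity

end Spectrum

section Multiplication

variable {α : Type*} [MeasurableSpace α] {μ : Measure α}

section Indicator

variable {F : Type*} [NormedAddCommGroup F] [NormedSpace ℂ F] {p : ℝ≥0∞} [Fact (1 ≤ p)]

/-- Multiplication by the indicator function of a measurable set on `Lᵖ`. -/
def mulIndicator {S : Set α} (hS : MeasurableSet S) : Lp F p μ →L[ℂ] Lp F p μ :=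
  LinearMap.mkContinuous
    { toFun := fun f => ((Lp.memLp f).indicator hS).toLp
      map_add' := fun f g => by
        rw [← MemLp.toLp_add, MemLp.toLp_eq_toLp_iff, ← Set.indicator_add']
        exact (Lp.coeFn_add f g).indicator
      map_smul' := fun c f => by
        rw [RingHom.id_apply, ← MemLp.toLp_const_smul, MemLp.toLp_eq_toLp_iff]
        exact (Lp.coeFn_smul c f).indicator.trans
          (Set.indicator_const_smul S c f).eventuallyEq } 1 fun f => by
    rw [one_mul]
    refine Lp.norm_le_norm_of_ae_le (((Lp.memLp f).indicator hS).coeFn_toLp.mono fun a ha => ?_)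
    exact (congrArg norm ha).trans_le (norm_indicator_le_norm_self _ _)

theorem mulIndicator_apply {S : Set α} (hS : MeasurableSet S) (f : Lp F p μ) :
    mulIndicator hS f = ((Lp.memLp f).indicator hS).toLp :=
  rfl

theorem coeFn_mulIndicator {S : Set α} (hS : MeasurableSet S) (f : Lp F p μ) :
    mulIndicator hS f =ᵐ[μ] S.indicator f :=
  ((Lp.memLp f).indicator hS).coeFn_toLp

theorem mulIndicator_univ :
    mulIndicator MeasurableSet.univ = (1 : Lp F p μ →L[ℂ] Lp F p μ) := by
  ext1 f
  exact Lp.ext <| (coeFn_mulIndicator MeasurableSet.univ f).trans (by rw [Set.indicator_univ]; rfl)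

theorem mulIndicator_inter {S T : Set α} (hS : MeasurableSet S) (hT : MeasurableSet T) :
    mulIndicator (hS.inter hT) = (mulIndicator hS * mulIndicator hT : Lp F p μ →L[ℂ] Lp F p μ) := by
  ext1 f
  exact Lp.ext <| calc
    ⇑(mulIndicator (hS.inter hT) f)
      =ᵐ[μ] (S ∩ T).indicator f := coeFn_mulIndicator (hS.inter hT) f
    _ = S.indicator (T.indicator f) := (Set.indicator_indicator S T f).symm
    _ =ᵐ[μ] S.indicator (mulIndicator hT f) := (coeFn_mulIndicator hT f).symm.indicator
    _ =ᵐ[μ] mulIndicator hS (mulIndicator hT f) := (coeFn_mulIndicator hS _).symm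

theorem mulIndicator_union {S T : Set α} (hS : MeasurableSet S) (hT : MeasurableSet T)
    (h : Disjoint S T) (f : Lp F p μ) :
    mulIndicator (hS.union hT) f = mulIndicator hS f + mulIndicator hT f := by
  refine Lp.ext ?_
  filter_upwards [coeFn_mulIndicator (hS.union hT) f, coeFn_mulIndicator hS f,
    coeFn_mulIndicator hT f, Lp.coeFn_add (mulIndicator hS f) (mulIndicator hT f)]
    with a hST_a hS_a hT_a h_add
  rw [h_add, Pi.add_apply, hST_a, hS_a, hT_a, Set.indicator_union_of_disjoint h]

theorem mulIndicator_biUnion_finset {ι : Type*} (t : Finset ι) {S : ι → Set α}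
    (hS : ∀ i, MeasurableSet (S i)) (hd : Pairwise fun i j => Disjoint (S i) (S j))
    (f : Lp F p μ) :
    mulIndicator (t.measurableSet_biUnion fun i _ => hS i) f = ∑ i ∈ t, mulIndicator (hS i) f := by
  classical
  induction t using Finset.induction_on with
  | empty =>
    refine Lp.ext ((coeFn_mulIndicator _ f).trans
      (EventuallyEq.trans ?_ (Lp.coeFn_zero F p μ).symm))
    simp [Pi.zero_def]
  | insert i t hi ih =>
    rw [Finset.sum_insert hi, ← ih, ← mulIndicator_union]
    · simp only [Finset.set_biUnion_insert]
    · exact Set.disjoint_iUnion₂_right.2 fun j hj => hd (ne_of_mem_of_not_mem hj hi).symm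

theorem hasSum_mulIndicator (hp : p ≠ ∞) {ι : Type*} [Countable ι] {S : ι → Set α}
    (hS : ∀ i, MeasurableSet (S i)) (hd : Pairwise fun i j => Disjoint (S i) (S j))
    (f : Lp F p μ) :
    HasSum (fun i => mulIndicator (hS i) f) (mulIndicator (MeasurableSet.iUnion hS) f) := by
  rw [HasSum, SummationFilter.unconditional_filter]
  simp only [← mulIndicator_biUnion_finset _ hS hd]
  simp only [mulIndicator_apply]
  refine tendsto_toLp_of_dominated hp (C := 1) _ _ (fun t => ae_of_all _ fun a => ?_) <|
    ae_of_all _ fun a => (tendsto_indicator_biUnion_finset S f a).mono_right (pure_le_nhds _)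
  rw [one_mul]
  exact norm_indicator_le_of_subset (Set.iUnion₂_subset_iUnion _ _) _ a

theorem isStarProjection_mulIndicator {F : Type*} [NormedAddCommGroup F] [InnerProductSpace ℂ F]
    [CompleteSpace F] {S : Set α} (hS : MeasurableSet S) :
    IsStarProjection (mulIndicator hS : Lp F 2 μ →L[ℂ] Lp F 2 μ) where
  isIdempotentElem := by
    rw [IsIdempotentElem, ← mulIndicator_inter]
    simp only [Set.inter_self]
  isSelfAdjoint := by
    refine ContinuousLinearMap.isSelfAdjoint_iff_isSymmetric.2 fun f g => ?_
    rw [L2.inner_def, L2.inner_def]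
    refine integral_congr_ae ?_
    filter_upwards [coeFn_mulIndicator hS f, coeFn_mulIndicator hS g] with a hf hg
    by_cases ha : a ∈ S <;> simp [hf, hg, ha]

end Indicator

variable {H : Type*} [NormedAddCommGroup H] [InnerProductSpace ℂ H] [CompleteSpace H]

open Classical in
/-- The resolution of the identity of the operator that corresponds under the unitary map `U` to
multiplication by `φ`. -/
def multiplicationResolution (U : H ≃ₗᵢ[ℂ] Lp ℂ 2 μ) {φ : α → ℂ} (hφ : Measurable φ) :
    ResolutionOfIdentity H where
  proj B := if hB : MeasurableSet B then U.symm.conjStarAlgEquiv (mulIndicator (hφ hB)) else 0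
  not_measurable B hB := dif_neg hB
  isStarProjection B hB := by
    rw [dif_pos hB]
    exact (isStarProjection_mulIndicator (hφ hB)).map _
  univ := by
    rw [dif_pos MeasurableSet.univ]
    exact (congrArg _ mulIndicator_univ).trans (map_one _)
  inter B C hB hC := by
    rw [dif_pos hB, dif_pos hC, dif_pos (hB.inter hC), ← map_mul]
    exact congrArg _ (mulIndicator_inter (hφ hB) (hφ hC))
  iUnion B hB hd x := by
    simp only [hB, MeasurableSet.iUnion hB, dif_pos, Set.preimage_iUnion,
      LinearIsometryEquiv.conjStarAlgEquiv_apply_apply, LinearIsometryEquiv.symm_symm]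
    exact (hasSum_mulIndicator ENNReal.ofNat_ne_top (fun n => hφ (hB n))
      (fun i j hij => (hd hij).preimage φ) (U x)).mapL
        (U.symm.toContinuousLinearEquiv : Lp ℂ 2 μ →L[ℂ] H)

variable (U : H ≃ₗᵢ[ℂ] Lp ℂ 2 μ) {φ : α → ℂ} (hφ : Measurable φ)

theorem map_multiplicationResolution_proj {B : Set ℂ} (hB : MeasurableSet B) (x : H) :
    U ((multiplicationResolution U hφ).proj B x) = mulIndicator (hφ hB) (U x) := by
  simp [multiplicationResolution, hB]

theorem multiplicationResolution_proj_eq_zero_iff [SigmaFinite μ] {B : Set ℂ}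
    (hB : MeasurableSet B) : (multiplicationResolution U hφ).proj B = 0 ↔ μ (φ ⁻¹' B) = 0 := by
  constructor
  · contrapose!
    intro hpos h0
    obtain ⟨S, hS, hSB, hS_pos, hS_fin⟩ :=
      Measure.exists_subset_measure_lt_top (hφ hB) (pos_iff_ne_zero.2 hpos)
    set u : Lp ℂ 2 μ := indicatorConstLp 2 hS hS_fin.ne 1
    have hu : mulIndicator (hφ hB) u = u := by
      refine Lp.ext ?_
      filter_upwards [coeFn_mulIndicator (hφ hB) u, indicatorConstLp_coeFn (p := 2) (hs := hS)
        (hμs := hS_fin.ne) (c := (1 : ℂ))] with a hmul hind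
      rw [hmul, Set.indicator_apply_eq_self, hind]
      exact fun ha => Set.indicator_of_notMem (fun haS => ha (hSB haS)) _
    have hu0 : u = 0 := by
      rw [← hu, ← U.apply_symm_apply u, ← map_multiplicationResolution_proj U hφ hB, h0, zero_apply,
        map_zero]
    have hnorm : ‖u‖ ≠ 0 := by
      rw [norm_indicatorConstLp two_ne_zero ENNReal.ofNat_ne_top, norm_one, one_mul]
      exact (Real.rpow_pos_of_pos (ENNReal.toReal_pos hS_pos.ne' hS_fin.ne) _).ne'
    exact hnorm (norm_eq_zero.2 hu0)
  · intro h0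
    ext x
    rw [zero_apply, ← U.map_eq_zero_iff, map_multiplicationResolution_proj U hφ hB]
    refine Lp.ext ?_
    filter_upwards [coeFn_mulIndicator (hφ hB) (U x), Lp.coeFn_zero ℂ 2 μ,
      measure_eq_zero_iff_ae_notMem.1 h0] with a hmul hzero ha
    rw [hmul, hzero, Set.indicator_of_notMem ha, Pi.zero_apply]

theorem multiplicationResolution_measure (x : H) :
    (multiplicationResolution U hφ).measure x =
      (μ.withDensity fun a => ‖U x a‖ₑ ^ 2).map φ := by
  refine Measure.ext fun B hB => ?_
  rw [ResolutionOfIdentity.measure_apply_eq_enorm_sq _ x hB, ← U.enorm_map,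
    map_multiplicationResolution_proj U hφ hB, Lp.enorm_def, eLpNorm_two_sq,
    Measure.map_apply hφ hB, withDensity_apply _ (hφ hB), ← lintegral_indicator (hφ hB)]
  refine lintegral_congr_ae ((coeFn_mulIndicator (hφ hB) (U x)).mono fun a ha => ?_)
  dsimp only
  rw [ha]
  by_cases haB : a ∈ φ ⁻¹' B <;> simp [haB]

theorem memLp_multiplicationResolution_iff {f : ℂ → ℂ} (hf : Measurable f) {x : H} :
    MemLp f 2 ((multiplicationResolution U hφ).measure x) ↔
      MemLp (fun a => f (φ a) * U x a) 2 μ := by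
  have hfU : AEStronglyMeasurable (fun a => f (φ a) * U x a) μ :=
    (hf.comp hφ).aestronglyMeasurable.mul (Lp.aestronglyMeasurable _)
  rw [memLp_two_iff hf.aestronglyMeasurable, memLp_two_iff hfU,
    multiplicationResolution_measure, lintegral_map (hf.enorm.pow_const 2) hφ,
    lintegral_withDensity_eq_lintegral_mul₀ ((Lp.aestronglyMeasurable _).enorm.pow_const 2)
      (g := fun a => ‖f (φ a)‖ₑ ^ 2) ((hf.comp hφ).enorm.pow_const 2).aemeasurable]
  simp [mul_pow, mul_comm]

theorem map_multiplicationResolution_simpleIntegral (s : SimpleFunc ℂ ℂ) (x : H) :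
    U ((multiplicationResolution U hφ).simpleIntegral s x) =ᵐ[μ] fun a => s (φ a) * U x a := by
  induction s using SimpleFunc.induction with
  | @const c B hB =>
    rw [ResolutionOfIdentity.simpleIntegral_indicator, smul_apply, map_smul,
      map_multiplicationResolution_proj U hφ hB]
    filter_upwards [Lp.coeFn_smul c (mulIndicator (hφ hB) (U x)),
      coeFn_mulIndicator (hφ hB) (U x)] with a h_smul h_ind
    rw [h_smul, Pi.smul_apply, h_ind]
    by_cases ha : φ a ∈ B <;> simp [ha]
  | @add s t _ hs ht =>
    rw [ResolutionOfIdentity.simpleIntegral_add, add_apply, map_add]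
    filter_upwards [Lp.coeFn_add (U ((multiplicationResolution U hφ).simpleIntegral s x))
      (U ((multiplicationResolution U hφ).simpleIntegral t x)), hs, ht] with a h_add hs_a ht_a
    rw [h_add, Pi.add_apply, hs_a, ht_a, SimpleFunc.coe_add, Pi.add_apply, add_mul]

theorem mem_integralGraph_multiplicationResolution {f : ℂ → ℂ} (hf : Measurable f) {x : H}
    (h : MemLp (fun a => f (φ a) * U x a) 2 μ) :
    (x, U.symm h.toLp) ∈ (multiplicationResolution U hφ).integralGraph f := by
  refine ⟨(memLp_two_iff hf.aestronglyMeasurable).1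
    ((memLp_multiplicationResolution_iff U hφ hf).2 h), fun s C hC hs => ?_⟩
  have hsU (n : ℕ) : MemLp (fun a => s n (φ a) * U x a) 2 μ :=
    (memLp_congr_ae (map_multiplicationResolution_simpleIntegral U hφ (s n) x)).1 (Lp.memLp _)
  have htoLp (n : ℕ) : (multiplicationResolution U hφ).simpleIntegral (s n) x =
      U.symm (hsU n).toLp := by
    rw [U.eq_symm_apply]
    exact Lp.ext ((map_multiplicationResolution_simpleIntegral U hφ (s n) x).trans
      (hsU n).coeFn_toLp.symm)
  simp only [htoLp]
  refine (U.symm.continuous.tendsto _).comp <| tendsto_toLp_of_dominated ENNReal.ofNat_ne_top h hsU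
    (C := C) (fun n => ae_of_all _ fun a => ?_) (ae_of_all _ fun a => (hs (φ a)).mul_const _)
  rw [norm_mul, norm_mul, ← mul_assoc]
  exact mul_le_mul_of_nonneg_right (hC n (φ a)) (norm_nonneg _)

theorem mem_integralGraph_multiplicationResolution_iff {f : ℂ → ℂ} (hf : Measurable f) {x y : H} :
    (x, y) ∈ (multiplicationResolution U hφ).integralGraph f ↔
      U y =ᵐ[μ] fun a => f (φ a) * U x a := by
  constructor
  · intro h
    have hL := (memLp_multiplicationResolution_iff U hφ hf).1
      (ResolutionOfIdentity.memLp_of_mem_integralGraph hf h)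
    rw [ResolutionOfIdentity.eq_of_mem_integralGraph hf h
      (mem_integralGraph_multiplicationResolution U hφ hf hL), U.apply_symm_apply]
    exact hL.coeFn_toLp
  · intro h
    have hL := (memLp_congr_ae h).1 (Lp.memLp (U y))
    convert mem_integralGraph_multiplicationResolution U hφ hf hL
    rw [U.eq_symm_apply]
    exact Lp.ext (h.trans hL.coeFn_toLp.symm)

theorem opSpectrum_integral_multiplicationResolution [TopologicalSpace α] [OpensMeasurableSpace α]
    [SigmaFinite μ] [μ.IsOpenPosMeasure] {ψ : α → ℂ} (hψ : Continuous ψ) :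
    opSpectrum ((multiplicationResolution U hψ.measurable).integral id) =
      closure (Set.range ψ) := by
  ext a
  rw [ResolutionOfIdentity.opSpectrum_integral measurable_id, Set.mem_ofPred_eq,
    Metric.mem_closure_range_iff]
  refine forall₂_congr fun ε hε => ?_
  rw [Set.preimage_id, Ne, multiplicationResolution_proj_eq_zero_iff _ _ measurableSet_ball,
    IsOpen.measure_eq_zero_iff μ (Metric.isOpen_ball.preimage hψ), ← Ne,
    ← Set.nonempty_iff_ne_empty]
  exact exists_congr fun _ => Metric.mem_ball'

end Multiplication

section AbsolutelyContinuous

variable {F : Type*} [NormedAddCommGroup F]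

theorem absolutelyContinuousOnInterval_of_dist_le {f : ℝ → F} {g : ℝ → ℝ} {a b : ℝ}
    (hg : AbsolutelyContinuousOnInterval g a b)
    (h : ∀ x ∈ Set.uIcc a b, ∀ y ∈ Set.uIcc a b, dist (f x) (f y) ≤ dist (g x) (g y)) :
    AbsolutelyContinuousOnInterval f a b := by
  refine squeeze_zero' (.of_forall fun _ => Finset.sum_nonneg fun _ _ => dist_nonneg) ?_ hg
  filter_upwards [mem_inf_of_right (mem_principal_self _)] with I hI
  refine Finset.sum_le_sum fun i hi => ?_
  obtain ⟨hx, hy⟩ := hI.1 i hi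
  exact h _ hx _ hy

theorem absolutelyContinuousOnInterval_intervalIntegral [NormedSpace ℝ F] {r : ℝ → F} {a b c : ℝ}
    (hr : IntervalIntegrable r volume a b) (hc : c ∈ Set.uIcc a b) :
    AbsolutelyContinuousOnInterval (fun t => ∫ u in c..t, r u) a b := by
  refine absolutelyContinuousOnInterval_of_dist_le
    (hr.norm.absolutelyContinuousOnInterval_intervalIntegral hc) fun x hx y hy => ?_
  have hcx := hr.mono_set (Set.uIcc_subset_uIcc hc hx)
  have hcy := hr.mono_set (Set.uIcc_subset_uIcc hc hy)
  rw [dist_eq_norm, dist_eq_norm, intervalIntegral.integral_interval_sub_left hcx hcy,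
    intervalIntegral.integral_interval_sub_left hcx.norm hcy.norm, Real.norm_eq_abs]
  exact intervalIntegral.norm_integral_le_abs_integral_norm

theorem locallyAC_and_ae_hasDerivAt_of_sub_eq_integral {g r : ℝ → ℂ} (hr : LocallyIntegrable r)
    (h : ∀ a b, g b - g a = ∫ u in a..b, r u) :
    LocallyAC g ∧ ∀ᵐ t, HasDerivAt g (r t) t := by
  have hg (a : ℝ) : g = fun t => (∫ u in a..t, r u) + g a := by
    ext t
    rw [← h, sub_add_cancel]
  constructor
  · intro a b
    rw [hg a]
    exact (absolutelyContinuousOnInterval_intervalIntegral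
      (hr.integrableOn_isCompact isCompact_uIcc).intervalIntegrable Set.left_mem_uIcc).add
        contDiffOn_const.absolutelyContinuousOnInterval
  · filter_upwards [LocallyIntegrable.ae_hasDerivAt_integral hr] with t ht
    rw [hg 0]
    exact (ht 0).add_const _

theorem integrable_of_memLp_two_of_memLp_two_smul [NormedSpace ℝ F] {P : ℝ → F} (hP : MemLp P 2)
    (hQ : MemLp (fun ξ => ξ • P ξ) 2) : Integrable P := by
  have hP_sq := (memLp_two_iff_integrable_sq_norm hP.1).1 hP
  have hQ_sq := (memLp_two_iff_integrable_sq_norm hQ.1).1 hQ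
  refine ((integrable_inv_one_add_sq.add (hP_sq.add hQ_sq)).div_const 2).mono' hP.1
    (ae_of_all _ fun ξ => ?_)
  -- AM-GM: `2 p ≤ w⁻¹ + w p²` with `w = 1 + ξ²`
  have h_amgm : 0 ≤ (1 + ξ ^ 2)⁻¹ * ((1 + ξ ^ 2) * ‖P ξ‖ - 1) ^ 2 := by positivity
  have h_expand : (1 + ξ ^ 2)⁻¹ * ((1 + ξ ^ 2) * ‖P ξ‖ - 1) ^ 2 =
      (1 + ξ ^ 2)⁻¹ + (‖P ξ‖ ^ 2 + ξ ^ 2 * ‖P ξ‖ ^ 2) - 2 * ‖P ξ‖ := by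
    have hw : 1 + ξ ^ 2 ≠ 0 := by positivity
    linear_combination ((1 + ξ ^ 2) * ‖P ξ‖ ^ 2 - 2 * ‖P ξ‖) * inv_mul_cancel₀ hw
  simp only [Pi.add_apply, norm_smul, mul_pow, Real.norm_eq_abs, sq_abs]
  linarith

end AbsolutelyContinuous

section Fourier

open FourierTransform SchwartzMap
open scoped ContDiff

section SchwartzTest

variable {V F : Type*} [NormedAddCommGroup V] [MeasurableSpace V] [BorelSpace V]
  [NormedAddCommGroup F]

theorem ae_eq_of_forall_integral_schwartzMap_smul_eq [NormedSpace ℝ V] [FiniteDimensional ℝ V]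
    [NormedSpace ℂ F] [CompleteSpace F] {μ : Measure V} {f g : V → F} (hf : LocallyIntegrable f μ)
    (hg : LocallyIntegrable g μ)
    (h : ∀ φ : 𝓢(V, ℂ), ∫ x, φ x • f x ∂μ = ∫ x, φ x • g x ∂μ) : f =ᵐ[μ] g := by
  refine ae_eq_of_integral_contDiff_smul_eq hf hg fun φ hφ hφ_supp => ?_
  have hφ_supp' : HasCompactSupport (Complex.ofRealCLM ∘ φ) := hφ_supp.comp_left rfl
  have hφ' : ContDiff ℝ ∞ (Complex.ofRealCLM ∘ φ) := by fun_prop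
  simpa using h (hφ_supp'.toSchwartzMap hφ')

variable [InnerProductSpace ℝ V] [FiniteDimensional ℝ V] [InnerProductSpace ℂ F] [CompleteSpace F]

theorem fourier_toLp_ae_eq {f : V → F} (h1 : Integrable f) (h2 : MemLp f 2) :
    (𝓕 h2.toLp : Lp F 2 (volume : Measure V)) =ᵐ[volume] 𝓕 f := by
  refine ae_eq_of_forall_integral_schwartzMap_smul_eq
    ((Lp.memLp _).locallyIntegrable one_le_two)
    (VectorFourier.fourierIntegral_continuous Real.continuous_fourierChar
      continuous_inner h1).locallyIntegrable fun φ => ?_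
  calc ∫ x, φ x • (𝓕 h2.toLp : Lp F 2 (volume : Measure V)) x
    _ = ∫ x, 𝓕 φ x • h2.toLp f x := by
      rw [← Lp.toTemperedDistribution_apply, ← Lp.fourier_toTemperedDistribution_eq,
        TemperedDistribution.fourier_apply, Lp.toTemperedDistribution_apply]
    _ = ∫ x, 𝓕 φ x • f x := integral_congr_ae (h2.coeFn_toLp.mono fun x hx => by simp only [hx])
    _ = ∫ x, φ x • 𝓕 f x := by
      simpa using! VectorFourier.integral_fourierIntegral_smul_eq_flip (L := innerₗ V)
        Real.continuous_fourierChar continuous_inner (φ.integrable (μ := volume)) h1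

theorem fourierInv_toLp_ae_eq {f : V → F} (h1 : Integrable f) (h2 : MemLp f 2) :
    (𝓕⁻ h2.toLp : Lp F 2 (volume : Measure V)) =ᵐ[volume] 𝓕⁻ f := by
  have h_cont : Continuous fun p : V × V => (-innerₗ V) p.1 p.2 := by
    simpa using! continuous_inner.neg
  refine ae_eq_of_forall_integral_schwartzMap_smul_eq
    ((Lp.memLp _).locallyIntegrable one_le_two)
    (VectorFourier.fourierIntegral_continuous Real.continuous_fourierChar
      h_cont h1).locallyIntegrable fun φ => ?_
  have h_flip : (-innerₗ V).flip = -innerₗ V := by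
    ext v w
    simp [real_inner_comm]
  calc ∫ x, φ x • (𝓕⁻ h2.toLp : Lp F 2 (volume : Measure V)) x
    _ = ∫ x, 𝓕⁻ φ x • h2.toLp f x := by
      rw [← Lp.toTemperedDistribution_apply, ← Lp.fourierInv_toTemperedDistribution_eq,
        TemperedDistribution.fourierInv_apply, Lp.toTemperedDistribution_apply]
    _ = ∫ x, 𝓕⁻ φ x • f x := integral_congr_ae (h2.coeFn_toLp.mono fun x hx => by simp only [hx])
    _ = ∫ x, φ x • 𝓕⁻ f x := by
      have := VectorFourier.integral_fourierIntegral_smul_eq_flip (L := -innerₗ V)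
        Real.continuous_fourierChar h_cont (φ.integrable (μ := volume)) h1
      rw [h_flip] at this
      simpa only [SchwartzMap.fourierInv_coe] using! this

end SchwartzTest

theorem conj_fourier_indicator_Ioc_mul {a b : ℝ} (hab : a ≤ b) (ξ : ℝ) :
    starRingEnd ℂ (𝓕 ((Set.Ioc a b).indicator fun _ => (1 : ℂ)) ξ) *
      (2 * Real.pi * Complex.I * ξ) = Real.fourierChar (b * ξ) - Real.fourierChar (a * ξ) := by
  rcases eq_or_ne ξ 0 with rfl | hξ
  · simp
  have hne : -(2 * Real.pi * Complex.I * ξ) ≠ 0 := by simp [Real.pi_ne_zero, hξ]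
  have h_fourier : 𝓕 ((Set.Ioc a b).indicator fun _ => (1 : ℂ)) ξ =
      ∫ t in a..b, Complex.exp (-(2 * Real.pi * Complex.I * ξ) * t) := by
    rw [Real.fourier_eq', intervalIntegral.integral_of_le hab,
      ← integral_indicator measurableSet_Ioc]
    refine integral_congr_ae (ae_of_all _ fun t => ?_)
    by_cases ht : t ∈ Set.Ioc a b
    · simp only [ht, Set.indicator_of_mem, smul_eq_mul, mul_one, RCLike.inner_apply, conj_trivial]
      push_cast
      ring_nf
    · simp [ht]
  rw [h_fourier, integral_exp_mul_complex hne, map_div₀, map_sub, ← Complex.exp_conj,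
    ← Complex.exp_conj, Real.fourierChar_apply, Real.fourierChar_apply]
  simp only [map_mul, map_neg, Complex.conj_I, Complex.conj_ofReal, map_ofNat, mul_neg, neg_mul,
    neg_neg]
  rw [div_mul_cancel₀ _ (neg_ne_zero.1 hne)]
  push_cast
  ring_nf

theorem fourierInv_sub_fourierInv_eq_integral {P Q : Lp ℂ 2 (volume : Measure ℝ)}
    (hP : Integrable P) (hPQ : Q =ᵐ[volume] fun ξ => 2 * Real.pi * Complex.I * ξ * P ξ) (a b : ℝ) :
    𝓕⁻ (P : ℝ → ℂ) b - 𝓕⁻ (P : ℝ → ℂ) a =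
      ∫ t in a..b, (𝓕⁻ Q : Lp ℂ 2 (volume : Measure ℝ)) t := by
  wlog hab : a ≤ b generalizing a b
  · rw [intervalIntegral.integral_symm, ← this b a (le_of_not_ge hab), neg_sub]
  have hfin : volume (Set.Ioc a b) ≠ (⊤ : ℝ≥0∞) := measure_Ioc_lt_top.ne
  have hP_char (t : ℝ) : Integrable fun ξ : ℝ => Real.fourierChar (inner ℝ ξ t) • P ξ := by
    simpa using! (VectorFourier.fourierIntegral_convergent_iff (L := innerₗ ℝ)
      Real.continuous_fourierChar continuous_inner (-t)).2 hP
  have h_ind := fourier_toLp_ae_eq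
    ((integrable_indicator_iff measurableSet_Ioc).2 (integrableOn_const (C := (1 : ℂ)) hfin))
    (memLp_indicator_const 2 measurableSet_Ioc (1 : ℂ) (Or.inr hfin))
  calc 𝓕⁻ (P : ℝ → ℂ) b - 𝓕⁻ (P : ℝ → ℂ) a
    _ = ∫ ξ : ℝ, (Real.fourierChar (b * ξ) - Real.fourierChar (a * ξ) : ℂ) * P ξ := by
      rw [Real.fourierInv_eq, Real.fourierInv_eq, ← integral_sub (hP_char b) (hP_char a)]
      simp only [Circle.smul_def, smul_eq_mul, sub_mul, RCLike.inner_apply, conj_trivial]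
    _ = inner ℂ (𝓕 (indicatorConstLp 2 measurableSet_Ioc hfin (1 : ℂ))) Q := by
      rw [L2.inner_def]
      refine integral_congr_ae ?_
      filter_upwards [hPQ, h_ind] with ξ hQ h_ind
      rw [indicatorConstLp, h_ind, hQ, ← conj_fourier_indicator_Ioc_mul hab, RCLike.inner_apply]
      ring
    _ = inner ℂ (indicatorConstLp 2 measurableSet_Ioc hfin (1 : ℂ)) (𝓕⁻ Q) := by
      rw [← Lp.inner_fourier_eq _ (𝓕⁻ Q), fourier_fourierInv_eq]
    _ = ∫ t in a..b, (𝓕⁻ Q : Lp ℂ 2 (volume : Measure ℝ)) t := by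
      rw [L2.inner_indicatorConstLp_one, intervalIntegral.integral_of_le hab]

theorem exists_locallyAC_fourierInv {P Q : Lp ℂ 2 (volume : Measure ℝ)}
    (hPQ : Q =ᵐ[volume] fun ξ => 2 * Real.pi * Complex.I * ξ * P ξ) :
    ∃ g : ℝ → ℂ, LocallyAC g ∧ (𝓕⁻ P : Lp ℂ 2 (volume : Measure ℝ)) =ᵐ[volume] g ∧
      ∀ᵐ t, HasDerivAt g ((𝓕⁻ Q : Lp ℂ 2 (volume : Measure ℝ)) t) t := by
  have hP : Integrable P := by
    refine integrable_of_memLp_two_of_memLp_two_smul (Lp.memLp P)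
      ((memLp_congr_ae (hPQ.mono fun ξ hξ => ?_)).1
        ((Lp.memLp Q).const_mul (2 * Real.pi * Complex.I)⁻¹))
    rw [hξ, Complex.real_smul]
    have := Complex.two_pi_I_ne_zero
    field_simp
  have h_ae := fourierInv_toLp_ae_eq hP (Lp.memLp P)
  rw [Lp.toLp_coeFn] at h_ae
  obtain ⟨h_ac, h_deriv⟩ := locallyAC_and_ae_hasDerivAt_of_sub_eq_integral
    ((Lp.memLp (𝓕⁻ Q)).locallyIntegrable one_le_two) (fourierInv_sub_fourierInv_eq_integral hP hPQ)
  exact ⟨_, h_ac, h_ae, h_deriv⟩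

end Fourier

section Weight

variable {c : ℝ}

theorem ae_weightMeasure : ae (weightMeasure c) = ae volume :=
  le_antisymm (weightMeasure_ac c).ae_le
    (withDensity_absolutelyContinuous' (by fun_prop)
      (ae_of_all _ fun t => by simp [Real.exp_pos])).ae_le

theorem aestronglyMeasurable_weightMeasure_iff {f : ℝ → ℂ} :
    AEStronglyMeasurable f (weightMeasure c) ↔ AEStronglyMeasurable f :=
  ⟨fun h => h.mono_ac (Measure.ae_le_iff_absolutelyContinuous.1 ae_weightMeasure.ge),
    fun h => h.mono_ac (weightMeasure_ac c)⟩

theorem eLpNorm_weightMeasure {f : ℝ → ℂ} (hf : AEStronglyMeasurable f) :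
    eLpNorm f 2 (weightMeasure c) =
      eLpNorm (fun t : ℝ => Complex.exp (-c * t) * f t) 2 volume := by
  refine (ENNReal.pow_right_strictMono two_ne_zero).injective ?_
  rw [eLpNorm_two_sq, eLpNorm_two_sq, weightMeasure,
    lintegral_withDensity_eq_lintegral_mul₀ (by fun_prop) (hf.enorm.pow_const 2)]
  refine lintegral_congr fun t => ?_
  have h_exp : ENNReal.ofReal (Real.exp (-2 * c * t)) = ‖Complex.exp (-c * t)‖ₑ ^ 2 := by
    rw [← ofReal_norm, ← ENNReal.ofReal_pow (norm_nonneg _), Complex.norm_exp, ← Real.exp_nat_mul]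
    simp [mul_assoc]
  rw [Pi.mul_apply, enorm_mul, mul_pow, h_exp]

theorem memLp_weightMeasure_iff {f : ℝ → ℂ} :
    MemLp f 2 (weightMeasure c) ↔ MemLp (fun t : ℝ => Complex.exp (-c * t) * f t) 2 := by
  have h_exp (a : ℂ) : AEStronglyMeasurable fun t : ℝ => Complex.exp (a * t) :=
    Continuous.aestronglyMeasurable (by fun_prop)
  have h_meas : AEStronglyMeasurable f ↔
      AEStronglyMeasurable fun t : ℝ => Complex.exp (-c * t) * f t := by
    refine ⟨(h_exp _).mul, fun h => ((h_exp c).mul h).congr (ae_of_all _ fun t => ?_)⟩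
    simp [← mul_assoc, ← Complex.exp_add]
  rw [MemLp, MemLp, aestronglyMeasurable_weightMeasure_iff, ← h_meas]
  exact and_congr_right fun hf => by rw [eLpNorm_weightMeasure hf]

theorem memLp_weightMeasure_exp_mul {f : ℝ → ℂ} (hf : MemLp f 2) :
    MemLp (fun t : ℝ => Complex.exp (c * t) * f t) 2 (weightMeasure c) := by
  rw [memLp_weightMeasure_iff]
  simpa [← mul_assoc, ← Complex.exp_add] using hf

variable (c) in
/-- Multiplication by `e^{-ct}` as a unitary map from `L²(ℝ, e^{-2ct} dt)` to `L²(ℝ)`. -/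
def unweight : WeightedL2 c ≃ₗᵢ[ℂ] Lp ℂ 2 (volume : Measure ℝ) :=
  LinearIsometryEquiv.ofSurjective
    { toFun f := (memLp_weightMeasure_iff.1 (Lp.memLp f)).toLp
      map_add' f g := by
        rw [← MemLp.toLp_add, MemLp.toLp_eq_toLp_iff]
        filter_upwards [ae_weightMeasure.ge (Lp.coeFn_add f g)] with t h_add
        rw [h_add, Pi.add_apply, Pi.add_apply, mul_add]
      map_smul' a f := by
        rw [RingHom.id_apply, ← MemLp.toLp_const_smul, MemLp.toLp_eq_toLp_iff]
        filter_upwards [ae_weightMeasure.ge (Lp.coeFn_smul a f)] with t h_smul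
        rw [h_smul, Pi.smul_apply, Pi.smul_apply, mul_smul_comm]
      norm_map' f := by
        change ‖(memLp_weightMeasure_iff.1 (Lp.memLp f)).toLp‖ = ‖f‖
        rw [Lp.norm_toLp, Lp.norm_def, eLpNorm_weightMeasure
          (aestronglyMeasurable_weightMeasure_iff.1 (Lp.aestronglyMeasurable f))] }
    fun g => by
      refine ⟨(memLp_weightMeasure_exp_mul (Lp.memLp g)).toLp,
        Lp.ext ((memLp_weightMeasure_iff.1 (Lp.memLp _)).coeFn_toLp.trans ?_)⟩
      filter_upwards [ae_weightMeasure.ge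
        (memLp_weightMeasure_exp_mul (c := c) (Lp.memLp g)).coeFn_toLp] with t ht
      rw [ht]
      simp [← mul_assoc, ← Complex.exp_add]

theorem coeFn_unweight (f : WeightedL2 c) :
    unweight c f =ᵐ[volume] fun t => Complex.exp (-c * t) * f t :=
  (memLp_weightMeasure_iff.1 (Lp.memLp f)).coeFn_toLp

end Weight

section Shift

open FourierTransform

variable {c : ℝ}

variable (c) in
/-- The Fourier transform of `e^{-ct} f(t)`, a unitary map that turns `∂_c` into multiplication by
`lineParam c`. -/
def spectralTransform : WeightedL2 c ≃ₗᵢ[ℂ] Lp ℂ 2 (volume : Measure ℝ) :=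
  (unweight c).trans (Lp.fourierTransformₗᵢ ℝ ℂ)

theorem fourierInv_spectralTransform (x : WeightedL2 c) :
    𝓕⁻ (spectralTransform c x) = unweight c x :=
  fourierInv_fourier_eq (unweight c x)

variable (c) in
/-- The parametrization `ξ ↦ c + 2πiξ` of the line `Re z = c`, with `ξ` the frequency in the
normalization of the Fourier transform by `e^{-2πitξ}`. -/
def lineParam (ξ : ℝ) : ℂ :=
  c + 2 * Real.pi * Complex.I * ξ

variable (c) in
theorem continuous_lineParam : Continuous (lineParam c) := by
  unfold lineParam
  fun_prop

theorem range_lineParam : Set.range (lineParam c) = {s : ℂ | s.re = c} := by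
  refine Set.Subset.antisymm (Set.range_subset_iff.2 fun ξ => by simp [lineParam]) fun z hz => ?_
  refine ⟨z.im / (2 * Real.pi), ?_⟩
  have := Real.pi_ne_zero
  calc lineParam c (z.im / (2 * Real.pi))
    _ = c + z.im * Complex.I := by
      rw [lineParam]
      push_cast
      field_simp
    _ = z := by rw [← hz, Complex.re_add_im]

variable (c) in
/-- The resolution of the identity of `∂_c`. -/
def shiftResolution : ResolutionOfIdentity (WeightedL2 c) :=
  multiplicationResolution (spectralTransform c) (continuous_lineParam c).measurable

theorem locallyAC_exp (a : ℂ) : LocallyAC fun t : ℝ => Complex.exp (a * t) := fun _ _ =>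
  (Complex.contDiff_exp.comp (contDiff_const.mul
    Complex.ofRealCLM.contDiff)).contDiffOn.absolutelyContinuousOnInterval

theorem LocallyAC.exp_mul {g : ℝ → ℂ} (hg : LocallyAC g) (a : ℂ) :
    LocallyAC fun t : ℝ => Complex.exp (a * t) * g t := fun p q =>
  (locallyAC_exp a p q).smul (hg p q)

theorem hasDerivAt_exp_mul {g : ℝ → ℂ} {a g' : ℂ} {t : ℝ} (h : HasDerivAt g g' t) :
    HasDerivAt (fun t : ℝ => Complex.exp (a * t) * g t)
      (Complex.exp (a * t) * (a * g t + g')) t := by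
  have h_exp : HasDerivAt (fun t : ℝ => Complex.exp (a * t)) (Complex.exp (a * t) * a) t := by
    simpa using! ((Complex.ofRealCLM.hasDerivAt (x := t)).const_mul a).cexp
  exact (h_exp.mul h).congr_deriv (by ring)

theorem LocallyAC.eq_exp_mul {g : ℝ → ℂ} (hg : LocallyAC g) {a : ℂ}
    (h : ∀ᵐ t, HasDerivAt g (a * g t) t) (t : ℝ) : g t = Complex.exp (a * t) * g 0 := by
  have h_deriv : ∀ᵐ u : ℝ, HasDerivAt (fun u : ℝ => Complex.exp (-a * u) * g u) 0 u := by
    filter_upwards [h] with u hu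
    simpa using hasDerivAt_exp_mul (a := -a) hu
  obtain ⟨C, hC⟩ := (hg.exp_mul (-a) 0 t).const_of_ae_hasDerivAt_zero
    (h_deriv.mono fun _ hu _ => hu)
  have h_const : Complex.exp (-a * t) * g t = g 0 := by
    rw [hC t Set.right_mem_uIcc, ← hC 0 Set.left_mem_uIcc]
    simp
  rw [← h_const, ← mul_assoc, ← Complex.exp_add]
  simp

theorem eq_zero_of_memLp_exp_mul {a k : ℂ}
    (h : MemLp (fun t : ℝ => Complex.exp (a * t) * k) 2) : k = 0 := by
  have h_neg := h.comp_measurePreserving (Measure.measurePreserving_neg (volume : Measure ℝ))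
  have h_const : Integrable fun _ : ℝ => k * k := by
    refine (h.integrable_mul h_neg).congr (ae_of_all _ fun t => ?_)
    simp [Complex.exp_neg, field]
  simpa [integrable_const_iff, isFiniteMeasure_iff] using h_const

theorem eq_zero_of_mem_shiftGraph {z : ℂ} {x : WeightedL2 c} (h : (x, z • x) ∈ shiftGraph c) :
    x = 0 := by
  obtain ⟨g, hg, hx, hx'⟩ := h
  have h_ode : ∀ᵐ t : ℝ, HasDerivAt g (z * g t) t := by
    filter_upwards [ae_weightMeasure.ge hx, ae_weightMeasure.ge hx',
      ae_weightMeasure.ge (hg.ae_differentiableAt c),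
      ae_weightMeasure.ge (Lp.coeFn_smul z x)] with t hx_t hx'_t hg_t h_smul
    rw [← hx_t, ← smul_eq_mul, ← Pi.smul_apply, ← h_smul, hx'_t]
    exact hg_t.hasDerivAt
  have h_exp : unweight c x =ᵐ[volume] fun t : ℝ => Complex.exp ((z - c) * t) * g 0 := by
    filter_upwards [coeFn_unweight x, ae_weightMeasure.ge hx] with t h_unweight hx_t
    rw [h_unweight, hx_t, hg.eq_exp_mul h_ode, ← mul_assoc, ← Complex.exp_add]
    ring_nf
  have h_zero : g 0 = 0 := eq_zero_of_memLp_exp_mul ((memLp_congr_ae h_exp).1 (Lp.memLp _))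
  rw [← (unweight c).map_eq_zero_iff, Lp.eq_zero_iff_ae_eq_zero]
  filter_upwards [h_exp] with t ht
  rw [ht, h_zero, mul_zero, Pi.zero_apply]

theorem integralGraph_shiftResolution_le :
    (shiftResolution c).integralGraph id ≤ shiftGraph c := by
  rintro ⟨x, y⟩ h
  have h_mul := (mem_integralGraph_multiplicationResolution_iff _ _ measurable_id).1 h
  have hPQ : spectralTransform c (y - (c : ℂ) • x) =ᵐ[volume]
      fun ξ => 2 * Real.pi * Complex.I * ξ * spectralTransform c x ξ := by
    rw [map_sub, map_smul]
    filter_upwards [h_mul, Lp.coeFn_sub (spectralTransform c y) ((c : ℂ) • spectralTransform c x),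
      Lp.coeFn_smul (c : ℂ) (spectralTransform c x)] with ξ h_mul_ξ h_sub h_smul
    rw [h_sub, Pi.sub_apply, h_mul_ξ, h_smul, Pi.smul_apply, smul_eq_mul, id_eq, lineParam]
    ring
  obtain ⟨g, hg, hxg, hyg⟩ := exists_locallyAC_fourierInv hPQ
  rw [fourierInv_spectralTransform] at hxg hyg
  have h_exp_inv (t : ℝ) (w : ℂ) : Complex.exp (c * t) * (Complex.exp (-c * t) * w) = w := by
    simp [← mul_assoc, ← Complex.exp_add]
  refine ⟨fun t => Complex.exp (c * t) * g t, hg.exp_mul c, ?_, ?_⟩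
  · refine ae_weightMeasure.le ?_
    filter_upwards [hxg, coeFn_unweight x] with t hxg_t hx_t
    rw [← hxg_t, hx_t, h_exp_inv]
  · refine ae_weightMeasure.le ?_
    filter_upwards [hxg, hyg, coeFn_unweight x, coeFn_unweight (y - (c : ℂ) • x),
      ae_weightMeasure.ge (Lp.coeFn_sub y ((c : ℂ) • x)),
      ae_weightMeasure.ge (Lp.coeFn_smul (c : ℂ) x)] with t hxg_t hyg_t hx_t hy_t h_sub h_smul
    rw [(hasDerivAt_exp_mul hyg_t).deriv, ← hxg_t, hx_t, hy_t, h_sub, Pi.sub_apply, h_smul,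
      Pi.smul_apply, smul_eq_mul, mul_left_comm (c : ℂ), ← mul_add, h_exp_inv, add_sub_cancel]

variable (c) in
theorem opSpectrum_integral_shiftResolution :
    opSpectrum ((shiftResolution c).integral id) = {s : ℂ | s.re = c} := by
  rw [shiftResolution, opSpectrum_integral_multiplicationResolution _ (continuous_lineParam c),
    range_lineParam]
  exact (isClosed_eq Complex.continuous_re continuous_const).closure_eq

variable (c) in
theorem integralGraph_shiftResolution : (shiftResolution c).integralGraph id = shiftGraph c := by
  have h : ((c + 1 : ℝ) : ℂ) ∉ opSpectrum ((shiftResolution c).integral id) := by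
    simp [opSpectrum_integral_shiftResolution]
  exact ResolutionOfIdentity.integralGraph_eq_of_le measurable_id integralGraph_shiftResolution_le
    (not_not.1 h) fun _ => eq_zero_of_mem_shiftGraph

variable (c) in
theorem isResolutionOf_shiftResolution :
    IsResolutionOf (shiftResolution c) (infinitesimalShift c) :=
  congrArg Submodule.toLinearPMap (integralGraph_shiftResolution c)

variable (c) in
theorem opSpectrum_infinitesimalShift :
    opSpectrum (infinitesimalShift c) = {s : ℂ | s.re = c} := by
  rw [← isResolutionOf_shiftResolution, opSpectrum_integral_shiftResolution]

theorem eq_zero_of_mem_graph_infinitesimalShift {z : ℂ} {x : WeightedL2 c}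
    (h : (x, z • x) ∈ (infinitesimalShift c).graph) : x = 0 := by
  rw [← isResolutionOf_shiftResolution, ResolutionOfIdentity.mem_graph_integral_iff measurable_id,
    integralGraph_shiftResolution] at h
  exact eq_zero_of_mem_shiftGraph h

end Shift

theorem measurable_riemannZeta : Measurable riemannZeta :=
  measurable_of_continuousOn_compl_singleton 1 fun _ hs =>
    (differentiableAt_riemannZeta hs).continuousAt.continuousWithinAt

end SpectralOp

end

open SpectralOp in
theorem theorem3p6_general (c : ℝ) {f : ℂ → ℂ} (hf : Measurable f) {N : Set ℂ} (hN : N.Countable)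
    (hcont : ∀ s, s.re = c → s ∉ N → ContinuousAt f s) :
    (∃ E : ResolutionOfIdentity (WeightedL2 c), IsResolutionOf E (infinitesimalShift c)) ∧
    opSpectrum (functionalCalculus (infinitesimalShift c) f) =
      closure (f '' (opSpectrum (infinitesimalShift c) \ N)) ∧
    opSpectrum (functionalCalculus (infinitesimalShift c) f) =
      closure (f '' ({s : ℂ | s.re = c} \ N)) := by
  have h_exists : ∃ E : ResolutionOfIdentity (WeightedL2 c),
      IsResolutionOf E (infinitesimalShift c) := ⟨_, isResolutionOf_shiftResolution c⟩
  have h_null : h_exists.choose.proj N = 0 :=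
    ResolutionOfIdentity.proj_eq_zero_of_countable hN fun z _ =>
      (ResolutionOfIdentity.proj_singleton_eq_zero_iff h_exists.choose_spec).2 fun _ =>
        eq_zero_of_mem_graph_infinitesimalShift
  have h_spectrum : opSpectrum (functionalCalculus (infinitesimalShift c) f) =
      closure (f '' (opSpectrum (infinitesimalShift c) \ N)) := by
    rw [functionalCalculus, dif_pos h_exists]
    refine ResolutionOfIdentity.opSpectrum_integral_eq_closure_image h_exists.choose_spec hf
      hN.measurableSet h_null fun s hs => ?_
    rw [opSpectrum_infinitesimalShift] at hs
    exact hcont s hs.1 hs.2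
  exact ⟨h_exists, h_spectrum, by rw [h_spectrum, opSpectrum_infinitesimalShift]⟩

open SpectralOp in
/-- The first conjunct says that the functional calculus of `∂_c`, hence `ζ(∂_c)`, is defined. The
pole `1` of `ζ` (on the line only when `c = 1`) is left out of the images. -/
theorem theorem3p6 (c : ℝ) (hc : 0 ≤ c) :
    (∃ E : ResolutionOfIdentity (WeightedL2 c), IsResolutionOf E (infinitesimalShift c)) ∧
    opSpectrum (spectralOperator c) =
      closure (riemannZeta '' (opSpectrum (infinitesimalShift c) \ {1})) ∧
    opSpectrum (spectralOperator c) =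
      closure (riemannZeta '' ({s : ℂ | s.re = c} \ {1})) :=
  theorem3p6_general c measurable_riemannZeta (Set.countable_singleton 1) fun _ _ hs =>
    (differentiableAt_riemannZeta hs).continuousAt
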